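/- Let $k$ be a field of characteristic $\neq 2$ and let $H_4$ be Sweedler's Hopf algebra over $k$, with basis $1,g,x,gx$, relations $g^2=1$, $x^2=0$, $xg=-gx$, and $\Delta(g)=g\otimes g$, $\Delta(x)=x\otimes 1+g\otimes x$, $\varepsilon(g)=1$, $\varepsilon(x)=0$. For $\beta\in k^*$ let $v_\beta$ be the Hopf algebra automorphism of $H_4$ with $v_\beta(g)=g$ and $v_\beta(x)=\beta x$. Let $A$ be a Hopf algebra over $k$ such that the only Hopf algebra map $A\to H_4$ is the trivial one, $z\mapsto\varepsilon(z)1$. Let $\mathcal{ZP}(A)$ be the set of central primitive elements of $A$, that is, of the central elements $a$ with $\Delta(a)=a\otimes 1+1\otimes a$. For $a\in\mathcal{ZP}(A)$ let $A_{(a)}$ be the crossed product Hopf algebra whose underlying coalgebra is the tensor product $A\otimes H_4$ (write $z\# h$ for $z\otimes h$), with unit $1\#1$ and multiplication $$(z\# h)(y\# l)=z\,y\,f_a(h_{(1)},l_{(1)})\#h_{(2)}l_{(2)},$$ where $f_a:H_4\otimes H_4\to A$ is the linear map with $f_a(1,1)=f_a(1,g)=f_a(g,1)=f_a(g,g)=1$,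 $f_a(x,x)=f_a(gx,x)=a$, $f_a(x,gx)=f_a(gx,gx)=-a$, and $f_a=0$ on all other pairs of basis elements. (1) For all $a,b\in\mathcal{ZP}(A)$ there is a bijection from the set of pairs $(u,\beta)\in\mathrm{Aut}_{\rm Hopf}(A)\times k^*$ with $u(a)=\beta^2 b$ onto the set of Hopf algebra isomorphisms $A_{(a)}\to A_{(b)}$; it sends $(u,\beta)$ to the map $\psi_{u,\beta}$ with $$\psi_{u,\beta}(z\# h)=u(z)\# v_\beta(h)\qquad(z\in A,\ h\in H_4).$$ (2) Consequently, for every $a\in\mathcal{ZP}(A)$, with the subgroup $G(a)=\{(u,\beta)\in\mathrm{Aut}_{\rm Hopf}(A)\times k^*\mid u(a)=\beta^2a\}$ of $\mathrm{Aut}_{\rm Hopf}(A)\times k^*$, the map $(u,\beta)\mapsto\psi_{u,\beta}$ is an isomorphism of groups $G(a)\cong\mathrm{Aut}_{\rm Hopf}(A_{(a)})$. -/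

import Mathlib

open scoped TensorProduct

noncomputable section

/-! ### Central primitive elements -/

/-- `P(A)`: the primitive elements, `Δ(a) = a ⊗ 1 + 1 ⊗ a`. -/
def primitiveElements (k A : Type*) [Field k] [Ring A] [HopfAlgebra k A] : Set A :=
  {a | Coalgebra.comul (R := k) a = a ⊗ₜ[k] 1 + 1 ⊗ₜ[k] a}

/-- `ZP(A) = P(A) ∩ Z(A)`: the central primitive elements. -/
def centralPrimitives (k A : Type*) [Field k] [Ring A] [HopfAlgebra k A] : Set A :=
  primitiveElements k A ∩ Set.center A

/-! ### The automorphism group of a Hopf algebra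

A Hopf algebra map is a bialgebra map (it commutes with the antipodes automatically). -/

/-- `Aut_Hopf(A)`, with composition as its product. -/
instance BialgEquiv.instGroupAut {k A : Type*} [Field k] [Ring A] [Bialgebra k A] :
    Group (A ≃ₐc[k] A) where
  mul u v := v.trans u
  one := BialgEquiv.refl k A
  inv u := u.symm
  mul_assoc _ _ _ := rfl
  one_mul _ := rfl
  mul_one _ := rfl
  inv_mul_cancel u := DFunLike.ext _ _ u.symm_apply_apply

theorem BialgEquiv.aut_mul_apply {k A : Type*} [Field k] [Ring A] [Bialgebra k A]
    (u v : A ≃ₐc[k] A) (z : A) : (u * v) z = u (v z) := rfl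

theorem BialgEquiv.aut_one_apply {k A : Type*} [Field k] [Ring A] [Bialgebra k A]
    (z : A) : (1 : A ≃ₐc[k] A) z = z := rfl

theorem BialgEquiv.aut_inv_apply_self {k A : Type*} [Field k] [Ring A] [Bialgebra k A]
    (u : A ≃ₐc[k] A) (z : A) : u⁻¹ (u z) = z := u.symm_apply_apply z

/-! ### Multiplication of a crossed product -/

section CrossedProduct

variable {k A H : Type*} [Field k] [Ring A] [HopfAlgebra k A] [Ring H] [HopfAlgebra k H]

/-- Left multiplication of `A` on `A ⊗ H`: `c ⊗ (a ⊗ h) ↦ c a ⊗ h`. -/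
def crossedLeft (k A H : Type*) [Field k] [Ring A] [HopfAlgebra k A] [Ring H]
    [HopfAlgebra k H] : A ⊗[k] (A ⊗[k] H) →ₗ[k] A ⊗[k] H :=
  (LinearMap.mul' k A).rTensor H ∘ₗ (TensorProduct.assoc k A A H).symm.toLinearMap

/-- `h ⊗ g ↦ f(h₁, g₁) ⊗ h₂ g₂`. -/
def crossedTwist (f : H →ₗ[k] H →ₗ[k] A) : H ⊗[k] H →ₗ[k] A ⊗[k] H :=
  TensorProduct.map (TensorProduct.lift f) (LinearMap.mul' k H) ∘ₗ
    (TensorProduct.tensorTensorTensorComm k H H H H).toLinearMap ∘ₗ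
    TensorProduct.map Coalgebra.comul Coalgebra.comul

/-- The multiplication of the crossed product `A # H` with action `act` and cocycle `f`,
`(a # h) (c # g) = a (h₁ ▷ c) f(h₂, g₁) # h₃ g₂` (see `crossedMul_tmul`). -/
def crossedMul (act : H →ₗ[k] A →ₗ[k] A) (f : H →ₗ[k] H →ₗ[k] A) :
    (A ⊗[k] H) ⊗[k] (A ⊗[k] H) →ₗ[k] A ⊗[k] H :=
  crossedLeft k A H ∘ₗ
    (crossedLeft k A H ∘ₗ TensorProduct.map (TensorProduct.lift act) (crossedTwist f) ∘ₗ
      (TensorProduct.tensorTensorTensorComm k H H A H).toLinearMap).lTensor A ∘ₗ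
    (TensorProduct.assoc k A (H ⊗[k] H) (A ⊗[k] H)).toLinearMap ∘ₗ
    (Coalgebra.comul.lTensor A).rTensor (A ⊗[k] H)

theorem crossedMul_tmul (act : H →ₗ[k] A →ₗ[k] A) (f : H →ₗ[k] H →ₗ[k] A)
    {ι κ l : Type*} (a c : A) (h g : H) (rh : Coalgebra.Repr k h ι)
    (rh' : ∀ i, Coalgebra.Repr k (rh.right i) κ) (rg : Coalgebra.Repr k g l) :
    crossedMul act f ((a ⊗ₜ h) ⊗ₜ (c ⊗ₜ g)) =
      ∑ i ∈ rh.index, ∑ j ∈ (rh' i).index, ∑ m ∈ rg.index,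
        (a * act (rh.left i) c * f ((rh' i).left j) (rg.left m)) ⊗ₜ[k]
          ((rh' i).right j * rg.right m) := by
  simp only [crossedMul, crossedLeft, crossedTwist, LinearMap.comp_apply,
    LinearMap.rTensor_tmul, LinearMap.lTensor_tmul, ← rh.eq, TensorProduct.sum_tmul,
    TensorProduct.tmul_sum, map_sum, LinearEquiv.coe_coe, TensorProduct.assoc_tmul,
    TensorProduct.tensorTensorTensorComm_tmul, TensorProduct.map_tmul, TensorProduct.lift.tmul]
  refine Finset.sum_congr rfl fun i _ => ?_
  simp only [← (rh' i).eq, ← rg.eq, TensorProduct.sum_tmul, TensorProduct.tmul_sum, map_sum,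
    TensorProduct.tensorTensorTensorComm_tmul, TensorProduct.map_tmul, TensorProduct.lift.tmul,
    LinearMap.mul'_apply, TensorProduct.assoc_symm_tmul, LinearMap.rTensor_tmul, mul_assoc]
  exact Finset.sum_comm

/-- The trivial action `h ▷ c = ε(h) c`. -/
def trivialAction (k A H : Type*) [Field k] [Ring A] [HopfAlgebra k A] [Ring H]
    [HopfAlgebra k H] : H →ₗ[k] A →ₗ[k] A :=
  LinearMap.lsmul k A ∘ₗ Coalgebra.counit

theorem trivialAction_apply (h : H) (c : A) :
    trivialAction k A H h c = Coalgebra.counit (R := k) h • c := rfl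

theorem crossedMul_trivialAction (f : H →ₗ[k] H →ₗ[k] A) (a c : A) (h g : H) :
    crossedMul (trivialAction k A H) f ((a ⊗ₜ h) ⊗ₜ (c ⊗ₜ g)) =
      (LinearMap.mulLeft k (a * c)).rTensor H (crossedTwist f (h ⊗ₜ g)) := by
  have key : ∀ w : A ⊗[k] H, ∀ b : A,
      crossedLeft k A H (b ⊗ₜ w) = (LinearMap.mulLeft k b).rTensor H w := by
    intro w b
    induction w with
    | zero => simp
    | add x y hx hy => simp [TensorProduct.tmul_add, hx, hy]
    | tmul x y => simp [crossedLeft]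
  have hc := Coalgebra.rTensor_counit_comul (R := k) h
  have e : (Coalgebra.counit (R := k) (A := H)).rTensor H (Coalgebra.comul h) = 1 ⊗ₜ h := hc
  have main : ∀ t : H ⊗[k] H, (crossedLeft k A H ∘ₗ
      TensorProduct.map (TensorProduct.lift (trivialAction k A H)) (crossedTwist f) ∘ₗ
      (TensorProduct.tensorTensorTensorComm k H H A H).toLinearMap) (t ⊗ₜ (c ⊗ₜ g)) =
      (LinearMap.mulLeft k c).rTensor H (crossedTwist f
        ((TensorProduct.lid k H ((Coalgebra.counit (R := k) (A := H)).rTensor H t)) ⊗ₜ g)) := by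
    intro t
    induction t with
    | zero => simp
    | add x y hx hy => simp only [TensorProduct.add_tmul, map_add, hx, hy]
    | tmul x y =>
      simp only [LinearMap.comp_apply, LinearEquiv.coe_coe,
        TensorProduct.tensorTensorTensorComm_tmul, TensorProduct.map_tmul,
        TensorProduct.lift.tmul, trivialAction_apply, key, LinearMap.rTensor_tmul,
        TensorProduct.lid_tmul, ← TensorProduct.smul_tmul', map_smul]
  simp only [crossedMul, LinearMap.comp_apply, LinearMap.rTensor_tmul, LinearMap.lTensor_tmul,
    LinearEquiv.coe_coe, TensorProduct.assoc_tmul]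
  have := main (Coalgebra.comul h)
  simp only [LinearMap.comp_apply, LinearEquiv.coe_coe] at this
  rw [this, e, key]
  simp only [TensorProduct.lid_tmul, one_smul]
  rw [← LinearMap.comp_apply, ← LinearMap.rTensor_comp, LinearMap.mulLeft_mul]

end CrossedProduct

/-! ### Sweedler's Hopf algebra -/

/-- The algebra underlying Sweedler's four-dimensional Hopf algebra `H₄`: it has the basis
`1, g, x, g x` with `g² = 1`, `x² = 0`, `x g = - g x`. As an algebra it is the (degenerate)
quaternion algebra with `i = g`, `j = x`, `i j = g x`, `i² = 1`, `j² = 0`, `j i = - i j`. -/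
abbrev SweedlerH4 (k : Type*) [Field k] : Type _ := QuaternionAlgebra k 1 0 0

namespace SweedlerH4

variable {k : Type*} [Field k]

variable (k) in
/-- The group-like generator `g`. -/
def g : SweedlerH4 k := ⟨0, 1, 0, 0⟩

variable (k) in
/-- The skew-primitive generator `x`. -/
def x : SweedlerH4 k := ⟨0, 0, 1, 0⟩

variable (k) in
/-- The basis `1, g, x, g x`. -/
def basis : Module.Basis (Fin 4) k (SweedlerH4 k) := QuaternionAlgebra.basisOneIJK 1 0 0

@[simp] theorem g_mul_g : g k * g k = 1 := by ext <;> simp [g]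
@[simp] theorem x_mul_x : x k * x k = 0 := by ext <;> simp [x]
@[simp] theorem x_mul_g : x k * g k = -(g k * x k) := by ext <;> simp [x, g]
@[simp] theorem g_mul_gx : g k * (g k * x k) = x k := by rw [← mul_assoc, g_mul_g, one_mul]
@[simp] theorem x_mul_gx : x k * (g k * x k) = 0 := by
  rw [← mul_assoc, x_mul_g, neg_mul, mul_assoc, x_mul_x, mul_zero, neg_zero]
@[simp] theorem gx_mul_g : g k * x k * g k = -x k := by
  rw [mul_assoc, x_mul_g, mul_neg, g_mul_gx]
@[simp] theorem gx_mul_x : g k * x k * x k = 0 := by rw [mul_assoc, x_mul_x, mul_zero]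
@[simp] theorem gx_mul_gx : g k * x k * (g k * x k) = 0 := by
  rw [mul_assoc, x_mul_gx, mul_zero]

theorem basis_eq : ⇑(basis k) = ![1, g k, x k, g k * x k] := by
  have h : ∀ i, basis k i = ![1, g k, x k, g k * x k] i := by
    intro i
    apply (basis k).repr.injective
    rw [Module.Basis.repr_self]
    ext j
    rw [basis, QuaternionAlgebra.coe_basisOneIJK_repr]
    fin_cases i <;> fin_cases j <;> simp [g, x]
  exact funext h

@[simp] theorem basis_zero : basis k 0 = 1 := by rw [basis_eq]; rfl
@[simp] theorem basis_one : basis k 1 = g k := by rw [basis_eq]; rfl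
@[simp] theorem basis_two : basis k 2 = x k := by rw [basis_eq]; rfl
@[simp] theorem basis_three : basis k 3 = g k * x k := by rw [basis_eq]; rfl

/-- Linear maps out of `H₄` which agree on `1, g, x, g x` are equal. -/
theorem hom_ext {M : Type*} [AddCommGroup M] [Module k M] {p q : SweedlerH4 k →ₗ[k] M}
    (h1 : p 1 = q 1) (hg : p (g k) = q (g k)) (hx : p (x k) = q (x k))
    (hgx : p (g k * x k) = q (g k * x k)) : p = q := by
  refine (basis k).ext fun i => ?_
  fin_cases i
  · simpa using h1
  · simpa using hg
  · simpa using hx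
  · simpa using hgx

/-- The linear map out of `H₄` with prescribed values on `1, g, x, g x`. -/
def lin {M : Type*} [AddCommGroup M] [Module k M] (v : Fin 4 → M) : SweedlerH4 k →ₗ[k] M :=
  (basis k).constr k v

section lin
variable {M : Type*} [AddCommGroup M] [Module k M] (v : Fin 4 → M)

@[simp] theorem lin_one : lin (k := k) v 1 = v 0 := by
  have := (basis k).constr_basis k v 0
  rwa [basis_zero] at this
@[simp] theorem lin_g : lin v (g k) = v 1 := by
  have := (basis k).constr_basis k v 1
  rwa [basis_one] at this
@[simp] theorem lin_x : lin v (x k) = v 2 := by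
  have := (basis k).constr_basis k v 2
  rwa [basis_two] at this
@[simp] theorem lin_gx : lin v (g k * x k) = v 3 := by
  have := (basis k).constr_basis k v 3
  rwa [basis_three] at this
end lin

/-- `Δ(g) = g ⊗ g`, `Δ(x) = x ⊗ 1 + g ⊗ x`, `ε(g) = 1`, `ε(x) = 0`. -/
instance instCoalgebraStruct : CoalgebraStruct k (SweedlerH4 k) where
  comul := lin ![1 ⊗ₜ 1, g k ⊗ₜ g k, x k ⊗ₜ 1 + g k ⊗ₜ x k,
    (g k * x k) ⊗ₜ g k + 1 ⊗ₜ (g k * x k)]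
  counit := lin ![1, 1, 0, 0]

@[simp] theorem comul_one' : Coalgebra.comul (R := k) (1 : SweedlerH4 k) = 1 ⊗ₜ 1 := lin_one _
@[simp] theorem comul_g : Coalgebra.comul (R := k) (g k) = g k ⊗ₜ g k := lin_g _
@[simp] theorem comul_x : Coalgebra.comul (R := k) (x k) = x k ⊗ₜ 1 + g k ⊗ₜ x k := lin_x _
@[simp] theorem comul_gx : Coalgebra.comul (R := k) (g k * x k) =
    (g k * x k) ⊗ₜ g k + 1 ⊗ₜ (g k * x k) := lin_gx _
@[simp] theorem counit_one' : Coalgebra.counit (R := k) (1 : SweedlerH4 k) = 1 := lin_one _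
@[simp] theorem counit_g : Coalgebra.counit (R := k) (g k) = 1 := lin_g _
@[simp] theorem counit_x : Coalgebra.counit (R := k) (x k) = 0 := lin_x _
@[simp] theorem counit_gx : Coalgebra.counit (R := k) (g k * x k) = 0 := lin_gx _

instance instCoalgebra : Coalgebra k (SweedlerH4 k) where
  coassoc := by
    apply hom_ext <;>
      simp [TensorProduct.add_tmul, TensorProduct.tmul_add, add_assoc]
  rTensor_counit_comp_comul := by apply hom_ext <;> simp
  lTensor_counit_comp_comul := by apply hom_ext <;> simp

instance instBialgebra : Bialgebra k (SweedlerH4 k) where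
  counit_one := counit_one'
  mul_compr₂_counit := by
    apply hom_ext <;> apply hom_ext <;> simp
  comul_one := comul_one'
  mul_compr₂_comul := by
    apply hom_ext <;> apply hom_ext <;>
      simp [mul_add, TensorProduct.neg_tmul, TensorProduct.tmul_neg] <;> abel

/-- `S(g) = g`, `S(x) = - g x`, `S(g x) = x`. -/
instance instHopfAlgebra : HopfAlgebra k (SweedlerH4 k) where
  antipode := lin ![1, g k, -(g k * x k), x k]
  mul_antipode_rTensor_comul := by
    apply hom_ext <;> simp [-Bialgebra.comul_one, -Bialgebra.comul_mul]
  mul_antipode_lTensor_comul := by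
    apply hom_ext <;> simp [-Bialgebra.comul_one, -Bialgebra.comul_mul]

@[simp] theorem antipode_g : HopfAlgebra.antipode k (g k) = g k := lin_g _
@[simp] theorem antipode_x : HopfAlgebra.antipode k (x k) = -(g k * x k) := lin_x _
@[simp] theorem antipode_gx : HopfAlgebra.antipode k (g k * x k) = x k := lin_gx _

/-- `v_β`: the linear map with `1 ↦ 1`, `g ↦ g`, `x ↦ β x`, `g x ↦ β g x`. -/
def scaleLin (β : k) : SweedlerH4 k →ₗ[k] SweedlerH4 k :=
  lin ![1, g k, β • x k, β • (g k * x k)]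

/-- The Hopf algebra endomorphism of `H₄` with `g ↦ g`, `x ↦ β x`. -/
def scaleHom (β : k) : SweedlerH4 k →ₐc[k] SweedlerH4 k :=
  { scaleLin β with
    map_one' := by simp [scaleLin]
    map_mul' := by
      have : LinearMap.compr₂ (LinearMap.mul k (SweedlerH4 k)) (scaleLin β) =
          (LinearMap.mul k (SweedlerH4 k)).compl₁₂ (scaleLin β) (scaleLin β) := by
        apply hom_ext <;> apply hom_ext <;> simp [scaleLin]
      exact fun p q => LinearMap.congr_fun (LinearMap.congr_fun this p) q
    counit_comp := by
      change Coalgebra.counit ∘ₗ scaleLin β = Coalgebra.counit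
      apply hom_ext <;> simp [scaleLin]
    map_comp_comul := by
      change TensorProduct.map (scaleLin β) (scaleLin β) ∘ₗ Coalgebra.comul =
        Coalgebra.comul ∘ₗ scaleLin β
      apply hom_ext <;> simp [scaleLin, -Bialgebra.comul_one, -Bialgebra.comul_mul,
        TensorProduct.smul_tmul'] }

/-- `v_β ∈ Aut_Hopf(H₄)` for `β ∈ k*`: `v_β(g) = g`, `v_β(x) = β x`, `v_β(g x) = β g x`. -/
def aut (β : kˣ) : SweedlerH4 k ≃ₐc[k] SweedlerH4 k :=
  have h : ∀ b c : k, b * c = 1 →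
      (scaleHom b).comp (scaleHom c) = BialgHom.id k (SweedlerH4 k) := by
    intro b c hbc
    have : scaleLin b ∘ₗ scaleLin c = LinearMap.id := by
      apply hom_ext <;> simp [scaleLin, smul_smul, mul_comm c b, hbc]
    exact DFunLike.ext _ _ fun p => LinearMap.congr_fun this p
  BialgEquiv.ofBialgHom (scaleHom β) (scaleHom (β⁻¹ : kˣ)) (h _ _ β.mul_inv) (h _ _ β.inv_mul)

theorem aut_apply_g (β : kˣ) : aut β (g k) = g k := lin_g _
theorem aut_apply_x (β : kˣ) : aut β (x k) = (β : k) • x k := lin_x _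
theorem aut_apply_gx (β : kˣ) : aut β (g k * x k) = (β : k) • (g k * x k) := lin_gx _

/-- The cocycle `f_a : H₄ ⊗ H₄ → A`, given by its table of values on `1, g, x, g x`
(rows: first argument, columns: second argument). -/
def cocycle {A : Type*} [Ring A] [HopfAlgebra k A] (a : A) :
    SweedlerH4 k →ₗ[k] SweedlerH4 k →ₗ[k] A :=
  lin fun i => lin fun j =>
    !![1, 1, 0,  0;
       1, 1, 0,  0;
       0, 0, a, -a;
       0, 0, a, -a] i j

end SweedlerH4

/-! ### The crossed products `A_(a)` -/

/-- The vector space underlying the crossed product `A_(a) = A # H₄`, namely `A ⊗ H₄`. -/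
def SweedlerCrossed {k A : Type*} [Field k] [Ring A] [HopfAlgebra k A]
    (_a : centralPrimitives k A) : Type _ := A ⊗[k] SweedlerH4 k

namespace SweedlerCrossed

open SweedlerH4

variable {k A : Type*} [Field k] [Ring A] [HopfAlgebra k A] (a : centralPrimitives k A)

instance instAddCommGroup : AddCommGroup (SweedlerCrossed a) :=
  inferInstanceAs (AddCommGroup (A ⊗[k] SweedlerH4 k))

instance instModule : Module k (SweedlerCrossed a) :=
  inferInstanceAs (Module k (A ⊗[k] SweedlerH4 k))

/-- The coalgebra structure of `A_(a)` is the tensor product of coalgebras `A ⊗ H₄`. -/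
instance instCoalgebra : Coalgebra k (SweedlerCrossed a) :=
  inferInstanceAs (Coalgebra k (A ⊗[k] SweedlerH4 k))

/-- The element `z # h` of `A_(a)`. -/
def tmul (z : A) (h : SweedlerH4 k) : SweedlerCrossed a := z ⊗ₜ[k] h

/-- The identity map `A_(a) → A ⊗ H₄` of underlying vector spaces. -/
def toTensor : SweedlerCrossed a ≃ₗ[k] A ⊗[k] SweedlerH4 k := LinearEquiv.refl k _

/-- The multiplication of `A_(a)` is that of the crossed product with the trivial action and the
cocycle `f_a`; the unit is `1 # 1`. -/
instance instMul : Mul (SweedlerCrossed a) where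
  mul p q := (toTensor a).symm (crossedMul (trivialAction k A (SweedlerH4 k)) (cocycle (a : A))
    (toTensor a p ⊗ₜ[k] toTensor a q))

theorem mul_def (p q : SweedlerCrossed a) : p * q = (toTensor a).symm
    (crossedMul (trivialAction k A (SweedlerH4 k)) (cocycle (a : A))
      (toTensor a p ⊗ₜ[k] toTensor a q)) := rfl

instance instOne : One (SweedlerCrossed a) where
  one := tmul a 1 1

variable {a}

theorem mul_tmul_tmul (z y : A) (h l : SweedlerH4 k) :
    tmul a z h * tmul a y l = (LinearMap.mulLeft k (z * y)).rTensor (SweedlerH4 k)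
      (crossedTwist (cocycle (a : A)) (h ⊗ₜ l)) :=
  crossedMul_trivialAction _ _ _ _ _

theorem tmul_add (z : A) (h l : SweedlerH4 k) : tmul a z (h + l) = tmul a z h + tmul a z l :=
  TensorProduct.tmul_add _ _ _
theorem add_tmul (z y : A) (h : SweedlerH4 k) : tmul a (z + y) h = tmul a z h + tmul a y h :=
  TensorProduct.add_tmul _ _ _
theorem tmul_neg (z : A) (h : SweedlerH4 k) : tmul a z (-h) = -tmul a z h :=
  TensorProduct.tmul_neg _ _
theorem neg_tmul (z : A) (h : SweedlerH4 k) : tmul a (-z) h = -tmul a z h :=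
  TensorProduct.neg_tmul _ _
theorem smul_tmul (c : k) (z : A) (h : SweedlerH4 k) : c • tmul a z h = tmul a (c • z) h :=
  TensorProduct.smul_tmul' _ _ _
theorem zero_tmul (h : SweedlerH4 k) : tmul a 0 h = 0 := TensorProduct.zero_tmul _ _
theorem tmul_zero (z : A) : tmul a z 0 = 0 := TensorProduct.tmul_zero _ _
theorem tmul_smul (c : k) (z : A) (h : SweedlerH4 k) : tmul a z (c • h) = c • tmul a z h :=
  TensorProduct.tmul_smul _ _ _
theorem one_def : (1 : SweedlerCrossed a) = tmul a 1 1 := rfl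

theorem induction_on {P : SweedlerCrossed a → Prop} (w : SweedlerCrossed a)
    (h1 : ∀ z, P (tmul a z 1)) (hg : ∀ z, P (tmul a z (g k))) (hx : ∀ z, P (tmul a z (x k)))
    (hgx : ∀ z, P (tmul a z (g k * x k))) (hadd : ∀ p q, P p → P q → P (p + q)) : P w := by
  have hb : ∀ (z : A) (h : SweedlerH4 k), P (tmul a z h) := by
    intro z h
    have e : h = h.re • (1 : SweedlerH4 k) + h.imI • g k + h.imJ • x k +
        h.imK • (g k * x k) := by
      ext <;> simp [g, x]
    rw [e]
    simp only [tmul_add, tmul_smul, smul_tmul]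
    exact hadd _ _ (hadd _ _ (hadd _ _ (h1 _) (hg _)) (hx _)) (hgx _)
  refine TensorProduct.induction_on (motive := P) w ?_ (fun z h => hb z h) hadd
  have := h1 0
  rwa [zero_tmul] at this

instance instNonUnitalNonAssocRing : NonUnitalNonAssocRing (SweedlerCrossed a) :=
  { instAddCommGroup a, instMul a with
    left_distrib := fun p q r => by
      simp only [mul_def, map_add, TensorProduct.tmul_add]
    right_distrib := fun p q r => by
      simp only [mul_def, map_add, TensorProduct.add_tmul]
    zero_mul := fun p => by
      simp only [mul_def, map_zero, TensorProduct.zero_tmul]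
    mul_zero := fun p => by
      simp only [mul_def, map_zero, TensorProduct.tmul_zero] }

theorem smul_mul (c : k) (p q : SweedlerCrossed a) : c • p * q = c • (p * q) := by
  simp only [mul_def, map_smul, ← TensorProduct.smul_tmul']

theorem mul_smul' (c : k) (p q : SweedlerCrossed a) : p * c • q = c • (p * q) := by
  simp only [mul_def, map_smul, TensorProduct.tmul_smul]

section table

variable (z y : A)

theorem one_mul_tmul (l : SweedlerH4 k) : tmul a z 1 * tmul a y l = tmul a (z * y) l := by
  have : crossedTwist (cocycle (a : A)) (1 ⊗ₜ l) = 1 ⊗ₜ l := by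
    have : crossedTwist (cocycle (a : A)) ∘ₗ TensorProduct.mk k _ _ 1 =
        TensorProduct.mk k _ _ 1 := by
      apply hom_ext <;> simp [crossedTwist, cocycle, -Bialgebra.comul_one, -Bialgebra.comul_mul,
        TensorProduct.tmul_add]
    exact LinearMap.congr_fun this l
  rw [mul_tmul_tmul, this, LinearMap.rTensor_tmul, LinearMap.mulLeft_apply, mul_one]; rfl

theorem g_mul_tmul (l : SweedlerH4 k) :
    tmul a z (g k) * tmul a y l = tmul a (z * y) (g k * l) := by
  have : crossedTwist (cocycle (a : A)) (g k ⊗ₜ l) = 1 ⊗ₜ (g k * l) := by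
    have : crossedTwist (cocycle (a : A)) ∘ₗ TensorProduct.mk k _ _ (g k) =
        TensorProduct.mk k _ _ 1 ∘ₗ LinearMap.mulLeft k (g k) := by
      apply hom_ext <;> simp [crossedTwist, cocycle, -Bialgebra.comul_one, -Bialgebra.comul_mul,
        TensorProduct.tmul_add]
    exact LinearMap.congr_fun this l
  rw [mul_tmul_tmul, this, LinearMap.rTensor_tmul, LinearMap.mulLeft_apply, mul_one]; rfl

theorem x_mul_one : tmul a z (x k) * tmul a y 1 = tmul a (z * y) (x k) := by
  have : crossedTwist (cocycle (a : A)) (x k ⊗ₜ 1) = 1 ⊗ₜ x k := by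
    simp [crossedTwist, cocycle, -Bialgebra.comul_one, -Bialgebra.comul_mul,
      TensorProduct.add_tmul]
  rw [mul_tmul_tmul, this, LinearMap.rTensor_tmul, LinearMap.mulLeft_apply, mul_one]; rfl

theorem x_mul_g : tmul a z (x k) * tmul a y (g k) = -tmul a (z * y) (g k * x k) := by
  have : crossedTwist (cocycle (a : A)) (x k ⊗ₜ g k) = -(1 ⊗ₜ (g k * x k)) := by
    simp [crossedTwist, cocycle, -Bialgebra.comul_one, -Bialgebra.comul_mul,
      TensorProduct.add_tmul, TensorProduct.tmul_neg]
  rw [mul_tmul_tmul, this, map_neg, LinearMap.rTensor_tmul, LinearMap.mulLeft_apply, mul_one]; rfl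

theorem x_mul_x : tmul a z (x k) * tmul a y (x k) = tmul a (z * y * a) 1 := by
  have : crossedTwist (cocycle (a : A)) (x k ⊗ₜ x k) = (a : A) ⊗ₜ 1 := by
    simp [crossedTwist, cocycle, -Bialgebra.comul_one, -Bialgebra.comul_mul,
      TensorProduct.add_tmul, TensorProduct.tmul_add]
  rw [mul_tmul_tmul, this, LinearMap.rTensor_tmul, LinearMap.mulLeft_apply]; rfl

theorem x_mul_gx : tmul a z (x k) * tmul a y (g k * x k) = -tmul a (z * y * a) (g k) := by
  have : crossedTwist (cocycle (a : A)) (x k ⊗ₜ (g k * x k)) = -((a : A) ⊗ₜ g k) := by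
    simp [crossedTwist, cocycle, -Bialgebra.comul_one, -Bialgebra.comul_mul,
      TensorProduct.add_tmul, TensorProduct.tmul_add, TensorProduct.neg_tmul]
  rw [mul_tmul_tmul, this, map_neg, LinearMap.rTensor_tmul, LinearMap.mulLeft_apply]; rfl

theorem gx_mul_one : tmul a z (g k * x k) * tmul a y 1 = tmul a (z * y) (g k * x k) := by
  have : crossedTwist (cocycle (a : A)) ((g k * x k) ⊗ₜ 1) = 1 ⊗ₜ (g k * x k) := by
    simp [crossedTwist, cocycle, -Bialgebra.comul_one, -Bialgebra.comul_mul,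
      TensorProduct.add_tmul]
  rw [mul_tmul_tmul, this, LinearMap.rTensor_tmul, LinearMap.mulLeft_apply, mul_one]; rfl

theorem gx_mul_g : tmul a z (g k * x k) * tmul a y (g k) = -tmul a (z * y) (x k) := by
  have : crossedTwist (cocycle (a : A)) ((g k * x k) ⊗ₜ g k) = -(1 ⊗ₜ x k) := by
    simp [crossedTwist, cocycle, -Bialgebra.comul_one, -Bialgebra.comul_mul,
      TensorProduct.add_tmul, TensorProduct.tmul_neg]
  rw [mul_tmul_tmul, this, map_neg, LinearMap.rTensor_tmul, LinearMap.mulLeft_apply, mul_one]; rfl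

theorem gx_mul_x : tmul a z (g k * x k) * tmul a y (x k) = tmul a (z * y * a) (g k) := by
  have : crossedTwist (cocycle (a : A)) ((g k * x k) ⊗ₜ x k) = (a : A) ⊗ₜ g k := by
    simp [crossedTwist, cocycle, -Bialgebra.comul_one, -Bialgebra.comul_mul,
      TensorProduct.add_tmul, TensorProduct.tmul_add]
  rw [mul_tmul_tmul, this, LinearMap.rTensor_tmul, LinearMap.mulLeft_apply]; rfl

theorem gx_mul_gx :
    tmul a z (g k * x k) * tmul a y (g k * x k) = -tmul a (z * y * a) 1 := by
  have : crossedTwist (cocycle (a : A)) ((g k * x k) ⊗ₜ (g k * x k)) = -((a : A) ⊗ₜ 1) := by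
    simp [crossedTwist, cocycle, -Bialgebra.comul_one, -Bialgebra.comul_mul,
      TensorProduct.add_tmul, TensorProduct.tmul_add, TensorProduct.neg_tmul]
  rw [mul_tmul_tmul, this, map_neg, LinearMap.rTensor_tmul, LinearMap.mulLeft_apply]; rfl

end table

theorem coe_comm (z : A) : (a : A) * z = z * a := (Set.mem_center_iff.1 a.2.2).comm z

theorem coe_comm' (z y : A) : (a : A) * (z * y) = z * (y * a) := by
  rw [coe_comm, mul_assoc]

theorem comul_coe : Coalgebra.comul (R := k) (a : A) = (a : A) ⊗ₜ[k] 1 + 1 ⊗ₜ[k] (a : A) := a.2.1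

theorem counit_coe : Coalgebra.counit (R := k) (a : A) = 0 := by
  have h := congrArg (TensorProduct.lid k A) (Coalgebra.rTensor_counit_comul (R := k) (a : A))
  rw [comul_coe, map_add, LinearMap.rTensor_tmul, LinearMap.rTensor_tmul, map_add,
    TensorProduct.lid_tmul, TensorProduct.lid_tmul, TensorProduct.lid_tmul,
    Bialgebra.counit_one, add_eq_right] at h
  have h' := congrArg (Coalgebra.counit (R := k)) h
  rwa [map_smul, Bialgebra.counit_one, map_zero, smul_eq_mul, mul_one] at h'

instance instRing : Ring (SweedlerCrossed a) :=
  { instAddCommGroup a, instNonUnitalNonAssocRing, instOne a with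
    one_mul := by
      intro p
      induction p using induction_on with
      | hadd p q hp hq => rw [mul_add, hp, hq]
      | _ => rw [one_def, one_mul_tmul, one_mul]
    mul_one := by
      intro p
      induction p using induction_on with
      | hadd p q hp hq => rw [add_mul, hp, hq]
      | _ => simp only [one_def, one_mul_tmul, g_mul_tmul, x_mul_one, gx_mul_one, mul_one]
    mul_assoc := by
      intro p q r
      induction p using induction_on with
      | hadd p q hp hq => simp only [add_mul, hp, hq]
      | _ =>
        induction q using induction_on with
        | hadd p q hp hq => simp only [add_mul, mul_add, hp, hq]
        | _ =>
          induction r using induction_on with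
          | hadd p q hp hq => simp only [mul_add, hp, hq]
          | _ =>
            simp only [one_mul_tmul, g_mul_tmul, x_mul_one, x_mul_g, x_mul_x, x_mul_gx,
              gx_mul_one, gx_mul_g, gx_mul_x, gx_mul_gx, mul_assoc, coe_comm,
              neg_mul, mul_neg, mul_one, neg_neg, g_mul_g, g_mul_gx] }

instance instAlgebra : Algebra k (SweedlerCrossed a) :=
  Algebra.ofModule smul_mul mul_smul'

variable (a) in
/-- `z ↦ z # h` as a linear map. -/
def inl (h : SweedlerH4 k) : A →ₗ[k] SweedlerCrossed a where
  toFun z := tmul a z h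
  map_add' z y := add_tmul z y h
  map_smul' c z := (smul_tmul c z h).symm

@[simp] theorem inl_apply (h : SweedlerH4 k) (z : A) : inl a h z = tmul a z h := rfl

variable (a) in
/-- `z ⊗ y ↦ (z # h) ⊗ (y # l)`. -/
def inl₂ (h l : SweedlerH4 k) : A ⊗[k] A →ₗ[k] SweedlerCrossed a ⊗[k] SweedlerCrossed a :=
  TensorProduct.map (inl a h) (inl a l)

@[simp] theorem inl₂_tmul (h l : SweedlerH4 k) (z y : A) :
    inl₂ a h l (z ⊗ₜ y) = tmul a z h ⊗ₜ tmul a y l := rfl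

theorem comul_tmul (z : A) (h : SweedlerH4 k) : Coalgebra.comul (R := k) (tmul a z h) =
    TensorProduct.map (toTensor a).symm.toLinearMap (toTensor a).symm.toLinearMap
      (TensorProduct.tensorTensorTensorComm k A A (SweedlerH4 k) (SweedlerH4 k)
        (Coalgebra.comul (R := k) z ⊗ₜ Coalgebra.comul (R := k) h)) := by
  have e : TensorProduct.map (toTensor a).symm.toLinearMap (toTensor a).symm.toLinearMap =
    LinearMap.id := TensorProduct.map_id
  rw [e]; rfl

theorem counit_tmul (z : A) (h : SweedlerH4 k) : Coalgebra.counit (R := k) (tmul a z h) =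
    Coalgebra.counit (R := k) h * Coalgebra.counit (R := k) z := rfl

theorem comm_aux (Q : A ⊗[k] A) (h l : SweedlerH4 k) :
    TensorProduct.map (toTensor a).symm.toLinearMap (toTensor a).symm.toLinearMap
      (TensorProduct.tensorTensorTensorComm k A A (SweedlerH4 k) (SweedlerH4 k)
        (Q ⊗ₜ (h ⊗ₜ l))) = inl₂ a h l Q := by
  induction Q with
  | zero => rw [TensorProduct.zero_tmul, LinearEquiv.map_zero, LinearMap.map_zero,
      LinearMap.map_zero]
  | add p q hp hq => rw [TensorProduct.add_tmul, LinearEquiv.map_add, LinearMap.map_add,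
      LinearMap.map_add, hp, hq]
  | tmul p q => rfl

theorem comul_tmul_one (z : A) : Coalgebra.comul (R := k) (tmul a z 1) =
    inl₂ a 1 1 (Coalgebra.comul (R := k) z) := by
  rw [comul_tmul, comul_one', comm_aux]

theorem comul_tmul_g (z : A) : Coalgebra.comul (R := k) (tmul a z (g k)) =
    inl₂ a (g k) (g k) (Coalgebra.comul (R := k) z) := by
  rw [comul_tmul, comul_g, comm_aux]

theorem comul_tmul_x (z : A) : Coalgebra.comul (R := k) (tmul a z (x k)) =
    inl₂ a (x k) 1 (Coalgebra.comul (R := k) z) +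
      inl₂ a (g k) (x k) (Coalgebra.comul (R := k) z) := by
  rw [comul_tmul, comul_x, TensorProduct.tmul_add, map_add, map_add, comm_aux, comm_aux]

theorem comul_tmul_gx (z : A) : Coalgebra.comul (R := k) (tmul a z (g k * x k)) =
    inl₂ a (g k * x k) (g k) (Coalgebra.comul (R := k) z) +
      inl₂ a 1 (g k * x k) (Coalgebra.comul (R := k) z) := by
  rw [comul_tmul, comul_gx, TensorProduct.tmul_add, map_add, map_add, comm_aux, comm_aux]

instance instBialgebra : Bialgebra k (SweedlerCrossed a) :=
  Bialgebra.mk' k _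
    (by rw [one_def, counit_tmul]; simp)
    (by
      intro p q
      induction p using induction_on with
      | hadd p q hp hq => simp only [add_mul, map_add, hp, hq]
      | _ =>
        induction q using induction_on with
        | hadd p q hp hq => simp only [mul_add, map_add, hp, hq]
        | _ =>
          simp [one_mul_tmul, g_mul_tmul, x_mul_one, x_mul_g, x_mul_x, x_mul_gx,
            gx_mul_one, gx_mul_g, gx_mul_x, gx_mul_gx, counit_tmul, counit_coe])
    (by rw [one_def, comul_tmul_one]; simp [Algebra.TensorProduct.one_def, one_def])
    (by
      intro p q
      induction p using induction_on with
      | hadd p q hp hq => simp only [add_mul, map_add, hp, hq]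
      | _ z =>
        induction q using induction_on with
        | hadd p q hp hq => simp only [mul_add, map_add, hp, hq]
        | _ y =>
          simp only [one_mul_tmul, g_mul_tmul, x_mul_one, x_mul_g, x_mul_x, x_mul_gx,
            gx_mul_one, gx_mul_g, gx_mul_x, gx_mul_gx, map_neg, mul_one, g_mul_g, g_mul_gx,
            comul_tmul_one, comul_tmul_g, comul_tmul_x, comul_tmul_gx,
            Bialgebra.comul_mul, comul_coe]
          generalize Coalgebra.comul (R := k) z = P
          generalize Coalgebra.comul (R := k) y = Q
          induction P with
          | zero => simp
          | add P P' h h' =>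
            simp only [_root_.add_mul, map_add, neg_add] at h h' ⊢
            rw [← sub_eq_zero] at h h' ⊢
            have e := congrArg₂ (· + ·) h h'
            rw [add_zero] at e
            refine Eq.trans ?_ e
            abel
          | tmul z z' =>
            induction Q with
            | zero => simp
            | add Q Q' h h' =>
              simp only [_root_.add_mul, _root_.mul_add, map_add, neg_add] at h h' ⊢
              rw [← sub_eq_zero] at h h' ⊢
              have e := congrArg₂ (· + ·) h h'
              rw [add_zero] at e
              refine Eq.trans ?_ e
              abel
            | tmul y y' =>
              simp only [inl₂_tmul, Algebra.TensorProduct.tmul_mul_tmul, mul_add, add_mul,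
                one_mul_tmul, g_mul_tmul, x_mul_one, x_mul_g, x_mul_x, x_mul_gx,
                gx_mul_one, gx_mul_g, gx_mul_x, gx_mul_gx, mul_one, g_mul_g, g_mul_gx,
                map_add, TensorProduct.neg_tmul, TensorProduct.tmul_neg, neg_add]
              try abel)

variable (a) in
/-- The antipode of `A_(a)`, `S(z # h) = S(z) # S(h)` (the action is trivial). -/
def antipodeLin : SweedlerCrossed a →ₗ[k] SweedlerCrossed a :=
  (toTensor a).symm.toLinearMap ∘ₗ
    TensorProduct.map (HopfAlgebra.antipode k) (HopfAlgebra.antipode k) ∘ₗ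
    (toTensor a).toLinearMap

@[simp] theorem antipodeLin_tmul (z : A) (h : SweedlerH4 k) :
    antipodeLin a (tmul a z h) =
      tmul a (HopfAlgebra.antipode k z) (HopfAlgebra.antipode k h) := rfl

theorem antipode_left_aux (Q : A ⊗[k] A) (h l m : SweedlerH4 k)
    (H : ∀ z y : A, tmul a z (HopfAlgebra.antipode k h) * tmul a y l = tmul a (z * y) m) :
    LinearMap.mul' k _ ((antipodeLin a).rTensor _ (inl₂ a h l Q)) =
      tmul a (LinearMap.mul' k A ((HopfAlgebra.antipode k).rTensor A Q)) m := by
  induction Q with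
  | zero => simp [zero_tmul]
  | add p q hp hq => simp only [map_add, hp, hq, add_tmul]
  | tmul p q => simp [H]

theorem antipode_right_aux (Q : A ⊗[k] A) (h l m : SweedlerH4 k)
    (H : ∀ z y : A, tmul a z h * tmul a y (HopfAlgebra.antipode k l) = tmul a (z * y) m) :
    LinearMap.mul' k _ ((antipodeLin a).lTensor _ (inl₂ a h l Q)) =
      tmul a (LinearMap.mul' k A ((HopfAlgebra.antipode k).lTensor A Q)) m := by
  induction Q with
  | zero => simp [zero_tmul]
  | add p q hp hq => simp only [map_add, hp, hq, add_tmul]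
  | tmul p q => simp [H]

theorem algebraMap_eq (c : k) :
    algebraMap k (SweedlerCrossed a) c = tmul a (algebraMap k A c) 1 := by
  rw [Algebra.algebraMap_eq_smul_one, Algebra.algebraMap_eq_smul_one, one_def, smul_tmul]

instance instHopfAlgebra : HopfAlgebra k (SweedlerCrossed a) where
  antipode := antipodeLin a
  mul_antipode_rTensor_comul := by
    ext p
    simp only [LinearMap.comp_apply, Algebra.linearMap_apply]
    induction p using induction_on with
    | hadd p q hp hq => simp only [map_add, hp, hq]
    | h1 z =>
      rw [comul_tmul_one, antipode_left_aux _ _ _ 1, counit_tmul]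
      · simp [algebraMap_eq]
      · simp [one_mul_tmul]
    | hg z =>
      rw [comul_tmul_g, antipode_left_aux _ _ _ 1, counit_tmul]
      · simp [algebraMap_eq]
      · simp [antipode_g, g_mul_tmul]
    | hx z =>
      rw [comul_tmul_x, map_add, map_add, antipode_left_aux _ _ _ (-(g k * x k)),
        antipode_left_aux _ _ _ (g k * x k), counit_tmul]
      · simp [tmul_neg]
      · simp [antipode_g, g_mul_tmul]
      · simp [antipode_x, tmul_neg, gx_mul_one]
    | hgx z =>
      rw [comul_tmul_gx, map_add, map_add, antipode_left_aux _ _ _ (-(g k * x k)),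
        antipode_left_aux _ _ _ (g k * x k), counit_tmul]
      · simp [tmul_neg]
      · simp [one_mul_tmul]
      · simp [antipode_gx, tmul_neg, x_mul_g]
  mul_antipode_lTensor_comul := by
    ext p
    simp only [LinearMap.comp_apply, Algebra.linearMap_apply]
    induction p using induction_on with
    | hadd p q hp hq => simp only [map_add, hp, hq]
    | h1 z =>
      rw [comul_tmul_one, antipode_right_aux _ _ _ 1, counit_tmul]
      · simp [algebraMap_eq]
      · simp [one_mul_tmul]
    | hg z =>
      rw [comul_tmul_g, antipode_right_aux _ _ _ 1, counit_tmul]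
      · simp [algebraMap_eq]
      · simp [antipode_g, g_mul_tmul]
    | hx z =>
      rw [comul_tmul_x, map_add, map_add, antipode_right_aux _ _ _ (x k),
        antipode_right_aux _ _ _ (-x k), counit_tmul]
      · simp [tmul_neg]
      · simp [antipode_x, tmul_neg, g_mul_tmul]
      · simp [x_mul_one]
    | hgx z =>
      rw [comul_tmul_gx, map_add, map_add, antipode_right_aux _ _ _ (-x k),
        antipode_right_aux _ _ _ (x k), counit_tmul]
      · simp [tmul_neg]
      · simp [antipode_gx, one_mul_tmul]
      · simp [antipode_g, tmul_neg, gx_mul_g]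

end SweedlerCrossed

/-- The subgroup `G(a) = {(u, β) | u(a) = β² a}` of `Aut_Hopf(A) × k*`. -/
def crossedAutSubgroup {k A : Type*} [Field k] [Ring A] [HopfAlgebra k A]
    (a : centralPrimitives k A) : Subgroup ((A ≃ₐc[k] A) × kˣ) where
  carrier := {p | p.1 (a : A) = (p.2 : k) ^ 2 • (a : A)}
  one_mem' := by simp [BialgEquiv.aut_one_apply]
  mul_mem' {p q} hp hq := by
    simp only [Set.mem_ofPred_eq, Prod.fst_mul, Prod.snd_mul, BialgEquiv.aut_mul_apply] at *
    rw [hq, map_smul, hp, smul_smul, Units.val_mul, mul_pow, mul_comm]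
  inv_mem' {p} hp := by
    simp only [Set.mem_ofPred_eq, Prod.fst_inv, Prod.snd_inv] at *
    have h := congrArg (fun z => p.1⁻¹ z) hp
    simp only [BialgEquiv.aut_inv_apply_self, map_smul] at h
    conv_rhs => rw [h]
    rw [smul_smul, ← mul_pow, Units.inv_mul, one_pow, one_smul]

theorem mem_crossedAutSubgroup {k A : Type*} [Field k] [Ring A] [HopfAlgebra k A]
    (a : centralPrimitives k A) (p : (A ≃ₐc[k] A) × kˣ) :
    p ∈ crossedAutSubgroup a ↔ p.1 (a : A) = (p.2 : k) ^ 2 • (a : A) := Iff.rfl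

end

/-! Consider P : A_(b) → A, z # h ↦ ε(h)z, and π : A_(b) → H₄, z # h ↦ ε(z)h. Both are coalgebra
maps. The map π is also multiplicative, since ε(b) = 0 makes the cocycle trivial after applying ε,
whereas P is not multiplicative unless b = 0. As the coalgebra is a tensor product, every w is
recovered from these maps in either order: w = P(w₁) # π(w₂) = P(w₂) # π(w₁) (`mkLin_comul`,
`mkLin_comm_comul`).

For a pair (u, β) with u(a) = β² b, the map u ⊗ v_β is a coalgebra map. The cocycle enters a product
of basis elements only when both factors contain x; there v_β contributes β², so the hypothesis is
exactly what makes the map multiplicative (`mapHom`).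

Conversely, let ψ : A_(a) → A_(b) be an isomorphism. On A # 1 the map πψ is a Hopf algebra map A →
H₄, hence trivial, so the first decomposition puts ψ(A # 1) inside A # 1; doing the same for the
inverse of ψ yields u. Next, πψ(1 # g) is group-like, so it is 1 or g. If it were 1, then πψ(1 # x)
would be primitive, hence 0, and πψ could not be onto H₄. So it is g, and πψ(1 # x) is
skew-primitive of the form c(1 - g) + βx, with β ≠ 0 again by surjectivity.

Comparing the two decompositions of ψ(1 # x) forces ψ(1 # g) = 1 # g and ψ(1 # x) ∈ 1 # H₄
(`apply_g_and_apply_x`). Anticommutation of x and g gives 2c = 0, so c = 0 in characteristic ≠ 2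
(`apply_x`), and the square of 1 # x gives u(a) = β² b (`baseEquiv_apply`). -/

noncomputable section

/-! ### Group-like, skew-primitive and primitive elements of H₄. -/

namespace SweedlerH4

variable {k : Type*} [Field k]

variable (k) in
/-- The coordinate functionals of the basis `1, g, x, g x`. -/
def coord (i : Fin 4) : SweedlerH4 k →ₗ[k] k := (basis k).coord i

theorem coord_one (i : Fin 4) : coord k i 1 = if i = 0 then 1 else 0 := by
  rw [← basis_zero, coord, Module.Basis.coord_apply, Module.Basis.repr_self,
    Finsupp.single_apply]
  simp only [eq_comm]

theorem coord_g (i : Fin 4) : coord k i (g k) = if i = 1 then 1 else 0 := by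
  rw [← basis_one, coord, Module.Basis.coord_apply, Module.Basis.repr_self,
    Finsupp.single_apply]
  simp only [eq_comm]

theorem coord_x (i : Fin 4) : coord k i (x k) = if i = 2 then 1 else 0 := by
  rw [← basis_two, coord, Module.Basis.coord_apply, Module.Basis.repr_self,
    Finsupp.single_apply]
  simp only [eq_comm]

theorem coord_gx (i : Fin 4) : coord k i (g k * x k) = if i = 3 then 1 else 0 := by
  rw [← basis_three, coord, Module.Basis.coord_apply, Module.Basis.repr_self,
    Finsupp.single_apply]
  simp only [eq_comm]

/-- The coefficient functionals on `H₄ ⊗ H₄`. -/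
def coord₂ (i j : Fin 4) : SweedlerH4 k ⊗[k] SweedlerH4 k →ₗ[k] k :=
  LinearMap.mul' k k ∘ₗ TensorProduct.map (coord k i) (coord k j)

theorem coord₂_tmul (i j : Fin 4) (h l : SweedlerH4 k) :
    coord₂ i j (h ⊗ₜ l) = coord k i h * coord k j l := rfl

theorem eq_sum_coord (h : SweedlerH4 k) :
    h = coord k 0 h • (1 : SweedlerH4 k) + coord k 1 h • g k + coord k 2 h • x k +
      coord k 3 h • (g k * x k) := by
  have := (basis k).sum_repr h
  rw [Fin.sum_univ_four, basis_zero, basis_one, basis_two, basis_three] at this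
  exact this.symm

theorem comul_eq (h : SweedlerH4 k) : Coalgebra.comul (R := k) h =
    coord k 0 h • (1 ⊗ₜ 1) + coord k 1 h • (g k ⊗ₜ g k) +
      coord k 2 h • (x k ⊗ₜ 1 + g k ⊗ₜ x k) +
      coord k 3 h • ((g k * x k) ⊗ₜ g k + 1 ⊗ₜ (g k * x k)) := by
  conv_lhs => rw [eq_sum_coord h]
  simp only [map_add, map_smul, comul_one', comul_g, comul_x, comul_gx]

theorem counit_eq (h : SweedlerH4 k) :
    Coalgebra.counit (R := k) h = coord k 0 h + coord k 1 h := by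
  conv_lhs => rw [eq_sum_coord h]
  simp only [map_add, map_smul, counit_one', counit_g, counit_x, counit_gx]
  simp

/-- The group-like elements of `H₄` are `1` and `g`. -/
theorem eq_one_or_eq_g {h : SweedlerH4 k} (hc : Coalgebra.comul (R := k) h = h ⊗ₜ h)
    (he : Coalgebra.counit (R := k) h = 1) : h = 1 ∨ h = g k := by
  have key : ∀ i j, coord₂ i j (Coalgebra.comul (R := k) h) = coord k i h * coord k j h :=
    fun i j => by rw [hc, coord₂_tmul]
  rw [counit_eq] at he
  -- With cᵢ the coordinates of h, the terms 1 ⊗ g, x ⊗ x and gx ⊗ gx are absent from Δ(h), so c₀c₁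
  -- = c₂² = c₃² = 0.
  have h01 := key 0 1
  have h22 := key 2 2
  have h33 := key 3 3
  simp [comul_eq, coord₂_tmul, coord_one, coord_g, coord_x, coord_gx,
    -Bialgebra.comul_one, -Bialgebra.comul_mul] at h01 h22 h33
  have e := eq_sum_coord h
  rw [h22, h33] at e
  rcases h01 with h0 | h1
  · rw [h0, zero_add] at he
    right; rw [e, h0, he]; simp
  · rw [h1, add_zero] at he
    left; rw [e, h1, he]; simp

/-- The `(1, g)`-primitive elements of `H₄`. -/
theorem eq_of_skewPrimitive_g {h : SweedlerH4 k}
    (hc : Coalgebra.comul (R := k) h = h ⊗ₜ 1 + g k ⊗ₜ h) :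
    h = coord k 0 h • (1 - g k) + coord k 2 h • x k := by
  have key : ∀ i j, coord₂ i j (Coalgebra.comul (R := k) h) =
      coord k i h * coord k j 1 + coord k i (g k) * coord k j h :=
    fun i j => by rw [hc, map_add, coord₂_tmul, coord₂_tmul]
  -- The coefficients of g ⊗ 1 and gx ⊗ 1 give c₁ = -c₀ and c₃ = 0.
  have h10 := key 1 0
  have h30 := key 3 0
  simp [comul_eq, coord₂_tmul, coord_one, coord_g, coord_x, coord_gx,
    -Bialgebra.comul_one, -Bialgebra.comul_mul] at h10 h30
  have e := eq_sum_coord h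
  rw [← h30, eq_neg_of_add_eq_zero_left h10.symm, zero_smul, add_zero] at e
  conv_lhs => rw [e]
  module

/-- The primitive elements of `H₄` vanish. -/
theorem eq_zero_of_primitive {h : SweedlerH4 k}
    (hc : Coalgebra.comul (R := k) h = h ⊗ₜ 1 + 1 ⊗ₜ h) : h = 0 := by
  have key : ∀ i j, coord₂ i j (Coalgebra.comul (R := k) h) =
      coord k i h * coord k j 1 + coord k i 1 * coord k j h :=
    fun i j => by rw [hc, map_add, coord₂_tmul, coord₂_tmul]
  -- The coefficient of 1 ⊗ 1 reads c₀ = 2c₀, so c₀ = 0 in every characteristic; those of g ⊗ 1, g ⊗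
  -- x and gx ⊗ 1 give c₁ = c₂ = c₃ = 0.
  have h00 := key 0 0
  have h10 := key 1 0
  have h12 := key 1 2
  have h30 := key 3 0
  simp [comul_eq, coord₂_tmul, coord_one, coord_g, coord_x, coord_gx,
    -Bialgebra.comul_one, -Bialgebra.comul_mul] at h00 h10 h12 h30
  have e := eq_sum_coord h
  rwa [h00, ← h10, h12, ← h30, zero_smul, zero_smul, zero_smul, zero_smul, add_zero, add_zero,
    add_zero] at e

@[simp] theorem scaleHom_one (β : k) : scaleHom β 1 = 1 := lin_one _
@[simp] theorem scaleHom_g (β : k) : scaleHom β (g k) = g k := lin_g _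
@[simp] theorem scaleHom_x (β : k) : scaleHom β (x k) = β • x k := lin_x _
theorem aut_apply (β : kˣ) (h : SweedlerH4 k) : aut β h = scaleHom (β : k) h := rfl

theorem scaleHom_scaleHom (b c : k) (h : SweedlerH4 k) :
    scaleHom b (scaleHom c h) = scaleHom (b * c) h := by
  have : scaleLin b ∘ₗ scaleLin c = scaleLin (b * c) := by
    apply hom_ext <;> simp [scaleLin, smul_smul, mul_comm c b]
  exact LinearMap.congr_fun this h

theorem scaleHom_one_apply (h : SweedlerH4 k) : scaleHom (1 : k) h = h := by
  have : scaleLin (1 : k) = LinearMap.id := by apply hom_ext <;> simp [scaleLin]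
  exact LinearMap.congr_fun this h

end SweedlerH4

namespace SweedlerCrossed

open SweedlerH4

variable {k A : Type*} [Field k] [Ring A] [HopfAlgebra k A]

/-! ### The projections of A_(b) to A and H₄, and the two decompositions. -/

section structureMaps

variable (b : centralPrimitives k A)

/-- The coalgebra map `A_(b) → A`, `z # h ↦ ε(h) z`. -/
def toBase : SweedlerCrossed b →ₗc[k] A :=
  ((Coalgebra.TensorProduct.rid k k A : A ⊗[k] k ≃ₗc[k] A) : A ⊗[k] k →ₗc[k] A).comp
    (Coalgebra.TensorProduct.map (CoalgHom.id k A)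
      (Bialgebra.counitBialgHom k (SweedlerH4 k) : SweedlerH4 k →ₗc[k] k))

@[simp] theorem toBase_tmul (z : A) (h : SweedlerH4 k) :
    toBase b (tmul b z h) = Coalgebra.counit (R := k) h • z := rfl

/-- The linear map underlying the Hopf algebra map `A_(b) → H₄`. -/
def toSweedlerCoalgHom : SweedlerCrossed b →ₗc[k] SweedlerH4 k :=
  ((Coalgebra.TensorProduct.lid k (SweedlerH4 k) : k ⊗[k] SweedlerH4 k ≃ₗc[k] SweedlerH4 k) :
      k ⊗[k] SweedlerH4 k →ₗc[k] SweedlerH4 k).comp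
    (Coalgebra.TensorProduct.map (Bialgebra.counitBialgHom k A : A →ₗc[k] k)
      (CoalgHom.id k (SweedlerH4 k)))

theorem toSweedlerCoalgHom_tmul (z : A) (h : SweedlerH4 k) :
    toSweedlerCoalgHom b (tmul b z h) = Coalgebra.counit (R := k) z • h := rfl

/-- The Hopf algebra map `A_(b) → H₄`, `z # h ↦ ε(z) h`. -/
def toSweedler : SweedlerCrossed b →ₐc[k] SweedlerH4 k :=
  { toSweedlerCoalgHom b with
    map_one' := by
      change toSweedlerCoalgHom b (tmul b 1 1) = 1
      rw [toSweedlerCoalgHom_tmul, Bialgebra.counit_one, one_smul]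
    map_mul' := fun p q => by
      change toSweedlerCoalgHom b (p * q) = toSweedlerCoalgHom b p * toSweedlerCoalgHom b q
      induction p using induction_on with
      | hadd p q hp hq => simp only [add_mul, map_add, hp, hq]
      | _ z =>
        induction q using induction_on with
        | hadd p q hp hq => simp only [mul_add, map_add, hp, hq]
        | _ y =>
          -- The products that carry the cocycle value b vanish under ε because ε(b) = 0, matching
          -- x² = 0 in H₄.
          simp [one_mul_tmul, g_mul_tmul, x_mul_one, x_mul_g, x_mul_x, x_mul_gx,
            gx_mul_one, gx_mul_g, gx_mul_x, gx_mul_gx, toSweedlerCoalgHom_tmul, counit_coe,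
            smul_smul, mul_comm] }

@[simp] theorem toSweedler_tmul (z : A) (h : SweedlerH4 k) :
    toSweedler b (tmul b z h) = Coalgebra.counit (R := k) z • h := rfl

/-- The Hopf algebra map `A → A_(b)`, `z ↦ z # 1`. -/
def ofBase : A →ₐc[k] SweedlerCrossed b :=
  { inl b 1 with
    map_one' := rfl
    map_mul' := fun z y => (one_mul_tmul z y 1).symm
    counit_comp := by
      ext z
      exact (counit_tmul (a := b) z 1).trans (by rw [Bialgebra.counit_one, one_mul])
    map_comp_comul := by
      ext z
      exact (comul_tmul_one z).symm }

/-- The linear map `z ⊗ h ↦ z # h`. -/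
def mkLin : A ⊗[k] SweedlerH4 k →ₗ[k] SweedlerCrossed b := (toTensor b).symm.toLinearMap

/-- The second factor loses z₂ to ε(z₂), and the counit axiom reassembles z. The remaining factor
ε(h) selects which summand of Δ(x) or Δ(gx) survives. -/
theorem mkLin_inl₂ (h l : SweedlerH4 k) (z : A) :
    mkLin b (TensorProduct.map (toBase b).toLinearMap (toSweedler b : _ →ₗ[k] SweedlerH4 k)
      (inl₂ b h l (Coalgebra.comul (R := k) z))) =
      Coalgebra.counit (R := k) h • tmul b z l := by
  have main : ∀ Q : A ⊗[k] A,
      mkLin b (TensorProduct.map (toBase b).toLinearMap (toSweedler b : _ →ₗ[k] SweedlerH4 k)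
        (inl₂ b h l Q)) = Coalgebra.counit (R := k) h •
          tmul b (TensorProduct.rid k A ((Coalgebra.counit (R := k)).lTensor A Q)) l := by
    intro Q
    induction Q with
    | zero => simp [zero_tmul]
    | add p q hp hq => simp only [map_add, hp, hq, add_tmul, smul_add]
    | tmul p q =>
      simp only [inl₂_tmul, TensorProduct.map_tmul, LinearMap.lTensor_tmul,
        TensorProduct.rid_tmul]
      change tmul b (Coalgebra.counit (R := k) h • p) (Coalgebra.counit (R := k) q • l) = _
      rw [tmul_smul, smul_tmul, smul_tmul, smul_smul, smul_smul, mul_comm]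
  rw [main, Coalgebra.lTensor_counit_comul, TensorProduct.rid_tmul, one_smul]

/-- The mirror image: the other counit axiom reassembles z, and now ε(l) selects the surviving
summand. -/
theorem mkLin_comm_inl₂ (h l : SweedlerH4 k) (z : A) :
    mkLin b (TensorProduct.comm k _ _
      (TensorProduct.map (toSweedler b : _ →ₗ[k] SweedlerH4 k) (toBase b).toLinearMap
      (inl₂ b h l (Coalgebra.comul (R := k) z)))) =
      Coalgebra.counit (R := k) l • tmul b z h := by
  have main : ∀ Q : A ⊗[k] A,
      mkLin b (TensorProduct.comm k _ _
        (TensorProduct.map (toSweedler b : _ →ₗ[k] SweedlerH4 k) (toBase b).toLinearMap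
        (inl₂ b h l Q))) = Coalgebra.counit (R := k) l •
          tmul b (TensorProduct.lid k A ((Coalgebra.counit (R := k)).rTensor A Q)) h := by
    intro Q
    induction Q with
    | zero => simp [zero_tmul]
    | add p q hp hq => simp only [map_add, hp, hq, add_tmul, smul_add]
    | tmul p q =>
      simp only [inl₂_tmul, TensorProduct.map_tmul, LinearMap.rTensor_tmul,
        TensorProduct.lid_tmul]
      change tmul b (Coalgebra.counit (R := k) l • q) (Coalgebra.counit (R := k) p • h) = _
      rw [tmul_smul, smul_tmul, smul_tmul, smul_smul, smul_smul, mul_comm]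
  rw [main, Coalgebra.rTensor_counit_comul, TensorProduct.lid_tmul, one_smul]

/-- `w = P(w₁) # π(w₂)` with `P : A_(b) → A` and `π : A_(b) → H₄`. -/
theorem mkLin_comul (w : SweedlerCrossed b) :
    mkLin b (TensorProduct.map (toBase b).toLinearMap (toSweedler b : _ →ₗ[k] SweedlerH4 k)
      (Coalgebra.comul (R := k) w)) = w := by
  induction w using induction_on with
  | hadd p q hp hq => simp only [map_add, hp, hq]
  | h1 z => rw [comul_tmul_one, mkLin_inl₂, counit_one', one_smul]
  | hg z => rw [comul_tmul_g, mkLin_inl₂, counit_g, one_smul]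
  | hx z =>
    rw [comul_tmul_x, map_add, map_add, mkLin_inl₂, mkLin_inl₂, counit_g, counit_x, one_smul,
      zero_smul, zero_add]
  | hgx z =>
    rw [comul_tmul_gx, map_add, map_add, mkLin_inl₂, mkLin_inl₂, counit_gx, counit_one',
      one_smul, zero_smul, zero_add]

/-- `w = P(w₂) # π(w₁)` with `P : A_(b) → A` and `π : A_(b) → H₄`. -/
theorem mkLin_comm_comul (w : SweedlerCrossed b) :
    mkLin b (TensorProduct.comm k _ _
      (TensorProduct.map (toSweedler b : _ →ₗ[k] SweedlerH4 k) (toBase b).toLinearMap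
      (Coalgebra.comul (R := k) w))) = w := by
  induction w using induction_on with
  | hadd p q hp hq => simp only [map_add, hp, hq]
  | h1 z => rw [comul_tmul_one, mkLin_comm_inl₂, counit_one', one_smul]
  | hg z => rw [comul_tmul_g, mkLin_comm_inl₂, counit_g, one_smul]
  | hx z =>
    rw [comul_tmul_x, map_add, map_add, map_add, mkLin_comm_inl₂, mkLin_comm_inl₂, counit_one',
      counit_x, one_smul, zero_smul, add_zero]
  | hgx z =>
    rw [comul_tmul_gx, map_add, map_add, map_add, mkLin_comm_inl₂, mkLin_comm_inl₂, counit_gx,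
      counit_g, one_smul, zero_smul, add_zero]

/-- The coefficient in `A` of a basis element of `H₄`. -/
def coeff (i : Fin 4) : SweedlerCrossed b →ₗ[k] A :=
  (TensorProduct.rid k A).toLinearMap ∘ₗ (coord k i).lTensor A ∘ₗ (toTensor b).toLinearMap

@[simp] theorem coeff_tmul (i : Fin 4) (z : A) (h : SweedlerH4 k) :
    coeff b i (tmul b z h) = coord k i h • z := rfl

theorem tmul_one_injective : Function.Injective fun z : A => tmul b z 1 := fun z y h => by
  simpa using congrArg (toBase b) h

end structureMaps

variable {a b : centralPrimitives k A}

/-- Together with `tmul_one_gx`, this shows that an algebra map out of A_(a) is determined by its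
values on A # 1, 1 # g and 1 # x. -/
theorem tmul_eq_mul (z : A) (h : SweedlerH4 k) : tmul a z h = tmul a z 1 * tmul a 1 h := by
  rw [one_mul_tmul, mul_one]

theorem tmul_one_gx : tmul a 1 (g k * x k) = tmul a 1 (g k) * tmul a 1 (x k) := by
  rw [g_mul_tmul, mul_one]

/-- Bialgebra equivalences out of `A_(a)` which agree on the elements `z # h` are equal. -/
theorem equiv_ext {f f' : SweedlerCrossed a ≃ₐc[k] SweedlerCrossed b}
    (h : ∀ z h, f (tmul a z h) = f' (tmul a z h)) : f = f' := by
  refine BialgEquiv.ext fun w => ?_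
  induction w using induction_on with
  | hadd p q hp hq => rw [map_add, map_add, hp, hq]
  | _ => exact h _ _

/-! ### The isomorphisms ψ_{u,β}. -/

section map

/-- The coalgebra map `u ⊗ v_β : A_(a) → A_(b)`. -/
def mapCoalgHom (a b : centralPrimitives k A) (u : A →ₐc[k] A) (β : k) :
    SweedlerCrossed a →ₗc[k] SweedlerCrossed b :=
  Coalgebra.TensorProduct.map (u : A →ₗc[k] A) (scaleHom β : SweedlerH4 k →ₗc[k] SweedlerH4 k)

theorem mapCoalgHom_tmul (u : A →ₐc[k] A) (β : k) (z : A) (h : SweedlerH4 k) :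
    mapCoalgHom a b u β (tmul a z h) = tmul b (u z) (scaleHom β h) := rfl

/-- The Hopf algebra map `ψ_{u,β} : A_(a) → A_(b)` when `u(a) = β² b`. -/
def mapHom (u : A →ₐc[k] A) (β : k) (hu : u (a : A) = β ^ 2 • (b : A)) :
    SweedlerCrossed a →ₐc[k] SweedlerCrossed b :=
  { mapCoalgHom a b u β with
    map_one' := by
      change mapCoalgHom a b u β (tmul a 1 1) = tmul b 1 1
      rw [mapCoalgHom_tmul, map_one, map_one]
    map_mul' := fun p q => by
      change mapCoalgHom a b u β (p * q) = mapCoalgHom a b u β p * mapCoalgHom a b u β q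
      induction p using induction_on with
      | hadd p q hp hq => simp only [add_mul, map_add, hp, hq]
      | _ z =>
        induction q using induction_on with
        | hadd p q hp hq => simp only [mul_add, map_add, hp, hq]
        | _ y =>
          -- In the four products where both factors contain x, the left side produces u(a) and the
          -- right side β² b; in the others β occurs at most once on each side.
          simp only [one_mul_tmul, g_mul_tmul, x_mul_one, x_mul_g, x_mul_x, x_mul_gx,
            gx_mul_one, gx_mul_g, gx_mul_x, gx_mul_gx, mapCoalgHom_tmul, map_neg, map_mul, hu,
            scaleHom_one, scaleHom_g, scaleHom_x, tmul_smul, smul_tmul, mul_one, g_mul_g,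
            g_mul_gx, mul_smul_comm, smul_mul_assoc, smul_smul, pow_two] }

theorem mapHom_tmul (u : A →ₐc[k] A) (β : k) (hu : u (a : A) = β ^ 2 • (b : A)) (z : A)
    (h : SweedlerH4 k) : mapHom u β hu (tmul a z h) = tmul b (u z) (scaleHom β h) := rfl

/-- The pair of inverses satisfies the same condition with a and b exchanged, so it supplies the
inverse of ψ_{u,β}. -/
theorem symm_apply_eq_of_apply_eq {u : A ≃ₐc[k] A} {β : kˣ}
    (hu : u (a : A) = (β : k) ^ 2 • (b : A)) :
    u.symm (b : A) = ((β⁻¹ : kˣ) : k) ^ 2 • (a : A) := by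
  have h := congrArg u.symm hu
  rw [BialgEquiv.symm_apply_apply, map_smul] at h
  rw [h, smul_smul, ← mul_pow, Units.inv_mul, one_pow, one_smul]

theorem mapHom_comp_eq_id {u u' : A →ₐc[k] A} {β β' : k} (hu : u (a : A) = β ^ 2 • (b : A))
    (hu' : u' (b : A) = β' ^ 2 • (a : A)) (h : ∀ z, u' (u z) = z) (hβ : β' * β = 1) :
    (mapHom u' β' hu').comp (mapHom u β hu) = BialgHom.id k (SweedlerCrossed a) := by
  refine BialgHom.ext fun w => ?_
  rw [BialgHom.comp_apply, BialgHom.id_apply]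
  induction w using induction_on with
  | hadd p q hp hq => rw [map_add, map_add, hp, hq]
  | _ => rw [mapHom_tmul, mapHom_tmul, scaleHom_scaleHom, hβ, scaleHom_one_apply, h]

/-- The Hopf algebra isomorphism `ψ_{u,β} : A_(a) ≃ A_(b)` when `u(a) = β² b`. -/
def mapEquiv (u : A ≃ₐc[k] A) (β : kˣ) (hu : u (a : A) = (β : k) ^ 2 • (b : A)) :
    SweedlerCrossed a ≃ₐc[k] SweedlerCrossed b :=
  BialgEquiv.ofBialgHom (mapHom (u : A →ₐc[k] A) β hu)
    (mapHom (u.symm : A →ₐc[k] A) ((β⁻¹ : kˣ) : k) (symm_apply_eq_of_apply_eq hu))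
    (mapHom_comp_eq_id _ _ u.apply_symm_apply β.mul_inv)
    (mapHom_comp_eq_id _ _ u.symm_apply_apply β.inv_mul)

theorem mapEquiv_tmul (u : A ≃ₐc[k] A) (β : kˣ) (hu : u (a : A) = (β : k) ^ 2 • (b : A))
    (z : A) (h : SweedlerH4 k) :
    mapEquiv u β hu (tmul a z h) = tmul b (u z) (aut β h) := rfl

end map

/-! ### Every isomorphism A_(a) → A_(b) has the form ψ_{u,β}. -/

section classification

/-- If all Hopf algebra maps `A → H₄` are trivial, Hopf algebra maps `A_(a) → A_(b)` restrict
to `A`. -/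
theorem apply_tmul_one
    (hA : ∀ (p : A →ₐc[k] SweedlerH4 k) (z : A), p z = Coalgebra.counit (R := k) z • 1)
    (ψ : SweedlerCrossed a →ₐc[k] SweedlerCrossed b) (z : A) :
    ψ (tmul a z 1) = tmul b (toBase b (ψ (tmul a z 1))) 1 := by
  let f : A →ₐc[k] SweedlerCrossed b := ψ.comp (ofBase a)
  -- Since πf : A → H₄ is trivial, P(f(z₁)) # π(f(z₂)) becomes P(f(z₁)) # ε(z₂)1, and the counit
  -- axiom collapses it to P(f(z)) # 1.
  have main : ∀ Q : A ⊗[k] A,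
      mkLin b (TensorProduct.map (toBase b).toLinearMap (toSweedler b : _ →ₗ[k] SweedlerH4 k)
        (TensorProduct.map (f : A →ₗ[k] SweedlerCrossed b)
          (f : A →ₗ[k] SweedlerCrossed b) Q)) =
      tmul b (toBase b (f (TensorProduct.rid k A ((Coalgebra.counit (R := k)).lTensor A Q))))
        1 := by
    intro Q
    induction Q with
    | zero => simp [zero_tmul]
    | add p q hp hq => simp only [map_add, hp, hq, add_tmul]
    | tmul p q =>
      rw [LinearMap.lTensor_tmul, TensorProduct.rid_tmul, map_smul, map_smul, ← smul_tmul,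
        ← tmul_smul]
      exact congrArg (tmul b (toBase b (f p))) (hA ((toSweedler b).comp f) q)
  have h := mkLin_comul b (f z)
  have hc : Coalgebra.comul (R := k) (f z) =
      TensorProduct.map (f : A →ₗ[k] SweedlerCrossed b) (f : A →ₗ[k] SweedlerCrossed b)
        (Coalgebra.comul (R := k) z) :=
    (CoalgHomClass.map_comp_comul_apply f z).symm
  rw [hc, main, Coalgebra.lTensor_counit_comul, TensorProduct.rid_tmul, one_smul] at h
  exact h.symm

/-- The endomorphism of `A` induced by a Hopf algebra map `A_(a) → A_(b)`. -/
def baseHom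
    (hA : ∀ (p : A →ₐc[k] SweedlerH4 k) (z : A), p z = Coalgebra.counit (R := k) z • 1)
    (ψ : SweedlerCrossed a →ₐc[k] SweedlerCrossed b) : A →ₐc[k] A :=
  { (toBase b).comp ((ψ : SweedlerCrossed a →ₗc[k] SweedlerCrossed b).comp
      (ofBase a : A →ₗc[k] SweedlerCrossed a)) with
    map_one' := by
      change toBase b (ψ 1) = 1
      rw [map_one, one_def, toBase_tmul, counit_one', one_smul]
    map_mul' := fun z y => by
      change toBase b (ψ (tmul a (z * y) 1)) =
        toBase b (ψ (tmul a z 1)) * toBase b (ψ (tmul a y 1))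
      -- The map P alone need not be multiplicative, so the identity is checked after embedding A as
      -- A # 1, where ψ and the embedding both are.
      apply tmul_one_injective b
      change tmul b _ 1 = tmul b _ 1
      rw [← apply_tmul_one hA, ← one_mul_tmul, map_mul, ← one_mul_tmul, ← apply_tmul_one hA,
        ← apply_tmul_one hA] }

theorem tmul_baseHom
    (hA : ∀ (p : A →ₐc[k] SweedlerH4 k) (z : A), p z = Coalgebra.counit (R := k) z • 1)
    (ψ : SweedlerCrossed a →ₐc[k] SweedlerCrossed b) (z : A) :
    tmul b (baseHom hA ψ z) 1 = ψ (tmul a z 1) := (apply_tmul_one hA ψ z).symm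

/-- The automorphism of `A` induced by a Hopf algebra isomorphism `A_(a) ≃ A_(b)`. -/
def baseEquiv
    (hA : ∀ (p : A →ₐc[k] SweedlerH4 k) (z : A), p z = Coalgebra.counit (R := k) z • 1)
    (ψ : SweedlerCrossed a ≃ₐc[k] SweedlerCrossed b) : A ≃ₐc[k] A :=
  BialgEquiv.ofBialgHom (baseHom hA (ψ : SweedlerCrossed a →ₐc[k] SweedlerCrossed b))
    (baseHom hA (ψ.symm : SweedlerCrossed b →ₐc[k] SweedlerCrossed a))
    (BialgHom.ext fun z => tmul_one_injective b <| by
      change tmul b (baseHom hA _ (baseHom hA _ z)) 1 = tmul b z 1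
      rw [tmul_baseHom, tmul_baseHom]
      exact ψ.apply_symm_apply _)
    (BialgHom.ext fun z => tmul_one_injective a <| by
      change tmul a (baseHom hA _ (baseHom hA _ z)) 1 = tmul a z 1
      rw [tmul_baseHom, tmul_baseHom]
      exact ψ.symm_apply_apply _)

theorem tmul_baseEquiv
    (hA : ∀ (p : A →ₐc[k] SweedlerH4 k) (z : A), p z = Coalgebra.counit (R := k) z • 1)
    (ψ : SweedlerCrossed a ≃ₐc[k] SweedlerCrossed b) (z : A) :
    tmul b (baseEquiv hA ψ z) 1 = ψ (tmul a z 1) :=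
  tmul_baseHom hA (ψ : SweedlerCrossed a →ₐc[k] SweedlerCrossed b) z

theorem comul_apply (ψ : SweedlerCrossed a ≃ₐc[k] SweedlerCrossed b) (w : SweedlerCrossed a) :
    Coalgebra.comul (R := k) (ψ w) = TensorProduct.map (ψ : _ →ₗ[k] SweedlerCrossed b)
      (ψ : _ →ₗ[k] SweedlerCrossed b) (Coalgebra.comul (R := k) w) :=
  (CoalgHomClass.map_comp_comul_apply ψ w).symm

theorem comul_apply_g (ψ : SweedlerCrossed a ≃ₐc[k] SweedlerCrossed b) :
    Coalgebra.comul (R := k) (ψ (tmul a 1 (g k))) =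
      ψ (tmul a 1 (g k)) ⊗ₜ ψ (tmul a 1 (g k)) := by
  rw [comul_apply, comul_tmul_g, Bialgebra.comul_one, Algebra.TensorProduct.one_def, inl₂_tmul]
  rfl

theorem comul_apply_x (ψ : SweedlerCrossed a ≃ₐc[k] SweedlerCrossed b) :
    Coalgebra.comul (R := k) (ψ (tmul a 1 (x k))) =
      ψ (tmul a 1 (x k)) ⊗ₜ 1 + ψ (tmul a 1 (g k)) ⊗ₜ ψ (tmul a 1 (x k)) := by
  rw [comul_apply, comul_tmul_x, Bialgebra.comul_one, Algebra.TensorProduct.one_def, inl₂_tmul,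
    inl₂_tmul, map_add, ← map_one ψ]
  rfl

theorem comul_toSweedler (w : SweedlerCrossed b) :
    Coalgebra.comul (R := k) (toSweedler b w) =
      TensorProduct.map (toSweedler b : _ →ₗ[k] SweedlerH4 k)
        (toSweedler b : _ →ₗ[k] SweedlerH4 k) (Coalgebra.comul (R := k) w) :=
  (CoalgHomClass.map_comp_comul_apply (toSweedler b) w).symm

theorem comul_toSweedler_apply_x (ψ : SweedlerCrossed a ≃ₐc[k] SweedlerCrossed b) :
    Coalgebra.comul (R := k) (toSweedler b (ψ (tmul a 1 (x k)))) =
      toSweedler b (ψ (tmul a 1 (x k))) ⊗ₜ 1 +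
        toSweedler b (ψ (tmul a 1 (g k))) ⊗ₜ toSweedler b (ψ (tmul a 1 (x k))) := by
  rw [comul_toSweedler, comul_apply_x, map_add, ← map_one (toSweedler b)]
  rfl

/-- By triviality of πψ on A # 1, the image of πψ is spanned by the images of 1 # 1, 1 # g, 1 # x
and 1 # gx. -/
theorem toSweedler_apply_tmul
    (hA : ∀ (p : A →ₐc[k] SweedlerH4 k) (z : A), p z = Coalgebra.counit (R := k) z • 1)
    (ψ : SweedlerCrossed a ≃ₐc[k] SweedlerCrossed b) (z : A) (h : SweedlerH4 k) :
    toSweedler b (ψ (tmul a z h)) =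
      Coalgebra.counit (R := k) z • toSweedler b (ψ (tmul a 1 h)) := by
  have e : toSweedler b (ψ (tmul a z 1)) = Coalgebra.counit (R := k) z • 1 :=
    hA ((toSweedler b).comp ((ψ : SweedlerCrossed a →ₐc[k] SweedlerCrossed b).comp (ofBase a))) z
  rw [tmul_eq_mul, map_mul, map_mul, e, smul_mul_assoc, one_mul]

/-- A Hopf algebra isomorphism `A_(a) ≃ A_(b)` followed by `A_(b) → H₄` is surjective, so the
coordinate of `x` does not vanish on its image. -/
theorem exists_coord_ne_zero
    (hA : ∀ (p : A →ₐc[k] SweedlerH4 k) (z : A), p z = Coalgebra.counit (R := k) z • 1)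
    (ψ : SweedlerCrossed a ≃ₐc[k] SweedlerCrossed b)
    (hg : coord k 2 (toSweedler b (ψ (tmul a 1 (g k)))) = 0)
    (hx : coord k 2 (toSweedler b (ψ (tmul a 1 (x k)))) = 0) :
    coord k 2 (toSweedler b (ψ (tmul a 1 (g k))) * toSweedler b (ψ (tmul a 1 (x k)))) ≠ 0 := by
  intro hgx
  have main : ∀ w : SweedlerCrossed a, coord k 2 (toSweedler b (ψ w)) = 0 := by
    intro w
    induction w using induction_on with
    | hadd p q hp hq => rw [map_add, map_add, map_add, hp, hq, add_zero]
    | h1 z =>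
      rw [toSweedler_apply_tmul hA, ← one_def, map_one, map_one, map_smul, coord_one]
      simp
    | hg z => rw [toSweedler_apply_tmul hA, map_smul, hg, smul_zero]
    | hx z => rw [toSweedler_apply_tmul hA, map_smul, hx, smul_zero]
    | hgx z =>
      rw [toSweedler_apply_tmul hA, tmul_one_gx, map_mul, map_mul, map_smul, hgx, smul_zero]
  -- The preimage of 1 # x under ψ is sent by πψ to x, whose x-coordinate is 1.
  have h := main (ψ.symm (tmul b 1 (x k)))
  rw [ψ.apply_symm_apply, toSweedler_tmul, Bialgebra.counit_one, one_smul, coord_x] at h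
  simp at h

theorem toSweedler_apply_g
    (hA : ∀ (p : A →ₐc[k] SweedlerH4 k) (z : A), p z = Coalgebra.counit (R := k) z • 1)
    (ψ : SweedlerCrossed a ≃ₐc[k] SweedlerCrossed b) :
    toSweedler b (ψ (tmul a 1 (g k))) = g k := by
  have hc : Coalgebra.comul (R := k) (toSweedler b (ψ (tmul a 1 (g k)))) =
      toSweedler b (ψ (tmul a 1 (g k))) ⊗ₜ toSweedler b (ψ (tmul a 1 (g k))) := by
    rw [comul_toSweedler, comul_apply_g]
    rfl
  have he : Coalgebra.counit (R := k) (toSweedler b (ψ (tmul a 1 (g k)))) = 1 := by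
    rw [CoalgHomClass.counit_comp_apply, CoalgHomClass.counit_comp_apply, counit_tmul, counit_g,
      Bialgebra.counit_one, one_mul]
  -- If g went to 1, the skew-primitive x would go to a primitive element, hence to 0, and so would
  -- gx; then the coordinate of x would vanish on the whole image.
  refine (eq_one_or_eq_g hc he).resolve_left fun h1 => ?_
  have hx : toSweedler b (ψ (tmul a 1 (x k))) = 0 := by
    apply eq_zero_of_primitive
    rw [comul_toSweedler_apply_x, h1]
  refine exists_coord_ne_zero hA ψ ?_ ?_ ?_
  · rw [h1, coord_one]; simp
  · rw [hx, map_zero]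
  · rw [hx, mul_zero, map_zero]

/-- Once g is known to be fixed, the comultiplication of x leaves only this form. The summand in 1 -
g is removed later, in `apply_x`, by using the product. -/
theorem toSweedler_apply_x
    (hA : ∀ (p : A →ₐc[k] SweedlerH4 k) (z : A), p z = Coalgebra.counit (R := k) z • 1)
    (ψ : SweedlerCrossed a ≃ₐc[k] SweedlerCrossed b) :
    toSweedler b (ψ (tmul a 1 (x k))) =
      coord k 0 (toSweedler b (ψ (tmul a 1 (x k)))) • (1 - g k) +
        coord k 2 (toSweedler b (ψ (tmul a 1 (x k)))) • x k :=
  eq_of_skewPrimitive_g <| by rw [comul_toSweedler_apply_x, toSweedler_apply_g hA]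

/-- The coordinate of `x` in the image of `1 # x` is a unit. -/
theorem coord_apply_x_ne_zero
    (hA : ∀ (p : A →ₐc[k] SweedlerH4 k) (z : A), p z = Coalgebra.counit (R := k) z • 1)
    (ψ : SweedlerCrossed a ≃ₐc[k] SweedlerCrossed b) :
    coord k 2 (toSweedler b (ψ (tmul a 1 (x k)))) ≠ 0 := by
  intro h0
  have e := toSweedler_apply_x hA ψ
  refine exists_coord_ne_zero hA ψ ?_ h0 ?_
  · rw [toSweedler_apply_g hA, coord_g]; simp
  -- Without an x-term, x goes to c(1 - g) and gx to c(g - 1), so neither image has an x-coordinate.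
  · rw [h0, zero_smul, add_zero] at e
    rw [toSweedler_apply_g hA, e, mul_smul_comm, mul_sub, mul_one, g_mul_g, map_smul, map_sub,
      coord_g, coord_one]
    simp

/-- `1 # g` is preserved, and the image of `1 # x` lies in `1 # H₄`. -/
theorem apply_g_and_apply_x
    (hA : ∀ (p : A →ₐc[k] SweedlerH4 k) (z : A), p z = Coalgebra.counit (R := k) z • 1)
    (ψ : SweedlerCrossed a ≃ₐc[k] SweedlerCrossed b) :
    ψ (tmul a 1 (g k)) = tmul b 1 (g k) ∧
      ψ (tmul a 1 (x k)) = tmul b 1 (toSweedler b (ψ (tmul a 1 (x k)))) := by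
  set G := ψ (tmul a 1 (g k)) with hG
  set X := ψ (tmul a 1 (x k)) with hX
  have hπ : toSweedler b G = g k := toSweedler_apply_g hA ψ
  have hP1 : toBase b 1 = 1 := by rw [one_def, toBase_tmul, counit_one', one_smul]
  -- As G is group-like with π(G) = g, the first decomposition reads G = P(G) # g.
  have eG : tmul b (toBase b G) (g k) = G := by
    have h := mkLin_comul b G
    rw [hG, comul_apply_g, ← hG, TensorProduct.map_tmul] at h
    rw [← hπ]
    exact h
  -- Both decompositions are applied to Δ(X) = X ⊗ 1 + G ⊗ X, giving P(X) # 1 + P(G) # π(X) here and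
  -- 1 # π(X) + P(X) # g in `eX'`.
  have eX : tmul b (toBase b X) 1 + tmul b (toBase b G) (toSweedler b X) = X := by
    have h := mkLin_comul b X
    rw [hX, comul_apply_x, ← hG, ← hX, map_add, map_add, TensorProduct.map_tmul,
      TensorProduct.map_tmul] at h
    rw [← map_one (toSweedler b)]
    exact h
  have eX' : tmul b 1 (toSweedler b X) + tmul b (toBase b X) (g k) = X := by
    have h := mkLin_comm_comul b X
    rw [hX, comul_apply_x, ← hG, ← hX, map_add, map_add, map_add, TensorProduct.map_tmul,
      TensorProduct.map_tmul] at h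
    rw [← hπ, ← hP1]
    exact h
  -- The x-coefficients of the two expressions for X are βP(G) and β1, with β ≠ 0.
  have hγ : toBase b G = 1 := by
    have h := congrArg (coeff b 2) (eX.trans eX'.symm)
    simp only [map_add, coeff_tmul, coord_one, coord_g] at h
    simp only [Fin.reduceEq, if_false, zero_smul, zero_add, add_zero] at h
    exact smul_right_injective A (coord_apply_x_ne_zero hA ψ) h
  -- With P(G) = 1 the terms 1 # π(X) cancel, leaving P(X) # 1 = P(X) # g.
  have hPX : toBase b X = 0 := by
    have h := eX.trans eX'.symm
    rw [hγ, add_comm, add_right_inj] at h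
    have h' := congrArg (coeff b 0) h
    simpa [coord_one, coord_g] using h'
  refine ⟨by rw [← eG, hγ], ?_⟩
  rw [hPX, zero_tmul, add_zero] at eX'
  exact eX'.symm

/-- The scalar `β` with `ψ(1 # x) = β (1 # x)`. -/
def scale
    (hA : ∀ (p : A →ₐc[k] SweedlerH4 k) (z : A), p z = Coalgebra.counit (R := k) z • 1)
    (ψ : SweedlerCrossed a ≃ₐc[k] SweedlerCrossed b) : kˣ :=
  Units.mk0 _ (coord_apply_x_ne_zero hA ψ)

/-- The part c(1 - g) of the image commutes with g, whereas x anticommutes with g; hence 2c = 0.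
This is where characteristic ≠ 2 is needed. -/
theorem apply_x (hk : ringChar k ≠ 2)
    (hA : ∀ (p : A →ₐc[k] SweedlerH4 k) (z : A), p z = Coalgebra.counit (R := k) z • 1)
    (ψ : SweedlerCrossed a ≃ₐc[k] SweedlerCrossed b) :
    ψ (tmul a 1 (x k)) = tmul b 1 ((scale hA ψ : k) • x k) := by
  have e := toSweedler_apply_x hA ψ
  have hxg : tmul a 1 (x k) * tmul a 1 (g k) = -(tmul a 1 (g k) * tmul a 1 (x k)) := by
    rw [SweedlerCrossed.x_mul_g, g_mul_tmul, mul_one]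
  -- The coordinate of g isolates c: it is c on one side and -c on the other, while the x-part
  -- contributes only multiples of gx.
  have h := congrArg (fun w => coord k 1 (toSweedler b (ψ w))) hxg
  simp only [map_mul, map_neg] at h
  rw [toSweedler_apply_g hA, e] at h
  simp only [add_mul, mul_add, smul_mul_assoc, mul_smul_comm, sub_mul, mul_sub, one_mul, mul_one,
    g_mul_g, SweedlerH4.x_mul_g, map_add, map_sub, map_smul, map_neg, coord_one, coord_g,
    coord_gx] at h
  have h0 : coord k 0 (toSweedler b (ψ (tmul a 1 (x k)))) = 0 := by
    simp only [Fin.reduceEq, if_false, if_true, smul_eq_mul, sub_zero, mul_one, neg_zero,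
      mul_zero, add_zero] at h
    have h2 : (2 : k) * coord k 0 (toSweedler b (ψ (tmul a 1 (x k)))) = 0 := by
      linear_combination h
    exact (mul_eq_zero.1 h2).resolve_left (Ring.two_ne_zero hk)
  rw [h0, zero_smul, zero_add] at e
  rw [(apply_g_and_apply_x hA ψ).2]
  exact congrArg (tmul b 1) e

/-- Every Hopf algebra isomorphism `A_(a) ≃ A_(b)` is `u ⊗ v_β` for some `u` and `β`. -/
theorem apply_tmul (hk : ringChar k ≠ 2)
    (hA : ∀ (p : A →ₐc[k] SweedlerH4 k) (z : A), p z = Coalgebra.counit (R := k) z • 1)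
    (ψ : SweedlerCrossed a ≃ₐc[k] SweedlerCrossed b) (z : A) (h : SweedlerH4 k) :
    ψ (tmul a z h) = tmul b (baseEquiv hA ψ z) (aut (scale hA ψ) h) := by
  have main : (ψ : _ →ₗ[k] SweedlerCrossed b) ∘ₗ mkLin a ∘ₗ TensorProduct.mk k _ _ 1 =
      mkLin b ∘ₗ TensorProduct.mk k _ _ 1 ∘ₗ scaleLin (scale hA ψ : k) := by
    apply hom_ext
    · change ψ 1 = tmul b 1 (aut (scale hA ψ) 1)
      rw [map_one, map_one, one_def]
    · change ψ (tmul a 1 (g k)) = tmul b 1 (aut (scale hA ψ) (g k))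
      rw [aut_apply_g, (apply_g_and_apply_x hA ψ).1]
    · change ψ (tmul a 1 (x k)) = tmul b 1 (aut (scale hA ψ) (x k))
      rw [aut_apply_x, apply_x hk]
    · change ψ (tmul a 1 (g k * x k)) = tmul b 1 (aut (scale hA ψ) (g k * x k))
      rw [tmul_one_gx, map_mul, (apply_g_and_apply_x hA ψ).1, apply_x hk hA, g_mul_tmul, mul_one,
        map_mul, aut_apply_g, aut_apply_x]
  have e : ψ (tmul a 1 h) = tmul b 1 (aut (scale hA ψ) h) := LinearMap.congr_fun main h
  rw [tmul_eq_mul z, map_mul, ← tmul_baseEquiv hA, e, one_mul_tmul, mul_one]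

/-- The relation (1 # x)² = a # 1 is carried by ψ to β² (1 # x)² = β² b # 1 in A_(b). -/
theorem baseEquiv_apply (hk : ringChar k ≠ 2)
    (hA : ∀ (p : A →ₐc[k] SweedlerH4 k) (z : A), p z = Coalgebra.counit (R := k) z • 1)
    (ψ : SweedlerCrossed a ≃ₐc[k] SweedlerCrossed b) :
    baseEquiv hA ψ (a : A) = (scale hA ψ : k) ^ 2 • (b : A) := by
  have h := map_mul ψ (tmul a 1 (x k)) (tmul a 1 (x k))
  rw [SweedlerCrossed.x_mul_x, apply_x hk hA, tmul_smul, smul_mul_assoc, mul_smul_comm,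
    SweedlerCrossed.x_mul_x, one_mul, one_mul, one_mul, smul_smul, smul_tmul, ← pow_two,
    ← tmul_baseEquiv hA] at h
  exact tmul_one_injective b h

end classification

/-! ### The bijection and the group isomorphism. -/

/-- The pairs `(u, β)` with `u(a) = β² b` correspond to the isomorphisms `A_(a) ≃ A_(b)`. -/
def pairEquiv (hk : ringChar k ≠ 2)
    (hA : ∀ (p : A →ₐc[k] SweedlerH4 k) (z : A), p z = Coalgebra.counit (R := k) z • 1)
    (a b : centralPrimitives k A) :
    {p : (A ≃ₐc[k] A) × kˣ // p.1 (a : A) = (p.2 : k) ^ 2 • (b : A)} ≃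
      (SweedlerCrossed a ≃ₐc[k] SweedlerCrossed b) where
  toFun p := mapEquiv p.1.1 p.1.2 p.2
  invFun ψ := ⟨(baseEquiv hA ψ, scale hA ψ), baseEquiv_apply hk hA ψ⟩
  left_inv p := by
    refine Subtype.ext (Prod.ext (BialgEquiv.ext fun z => ?_) (Units.ext ?_))
    · apply tmul_one_injective b
      change tmul b _ 1 = tmul b _ 1
      rw [tmul_baseEquiv hA, mapEquiv_tmul, map_one]
    -- The scalar is recovered as the x-coordinate of π(ψ(1 # x)), which for ψ_{u,β} is β.
    · change coord k 2 (toSweedler b (mapEquiv p.1.1 p.1.2 p.2 (tmul a 1 (x k)))) = _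
      rw [mapEquiv_tmul, aut_apply_x, map_one, toSweedler_tmul, Bialgebra.counit_one, one_smul,
        map_smul, coord_x, if_pos rfl, smul_eq_mul, mul_one]
  right_inv ψ := equiv_ext fun z h => by rw [mapEquiv_tmul, apply_tmul hk hA]

theorem pairEquiv_tmul (hk : ringChar k ≠ 2)
    (hA : ∀ (p : A →ₐc[k] SweedlerH4 k) (z : A), p z = Coalgebra.counit (R := k) z • 1)
    (a b : centralPrimitives k A)
    (p : {p : (A ≃ₐc[k] A) × kˣ // p.1 (a : A) = (p.2 : k) ^ 2 • (b : A)}) (z : A)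
    (h : SweedlerH4 k) :
    pairEquiv hk hA a b p (tmul a z h) = tmul b (p.1.1 z) (aut p.1.2 h) := rfl

end SweedlerCrossed

end

theorem mainTheorem4 {k A : Type*} [Field k] (hk : ringChar k ≠ 2) [Ring A] [HopfAlgebra k A]
    (hA : ∀ (p : A →ₐc[k] SweedlerH4 k) (z : A), p z = Coalgebra.counit (R := k) z • 1) :
    (∀ a b : centralPrimitives k A,
      ∃ Ψ : {p : (A ≃ₐc[k] A) × kˣ // p.1 (a : A) = (p.2 : k) ^ 2 • (b : A)} ≃
          (SweedlerCrossed a ≃ₐc[k] SweedlerCrossed b),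
        ∀ p (z : A) (h : SweedlerH4 k),
          Ψ p (SweedlerCrossed.tmul a z h) =
            SweedlerCrossed.tmul b (p.1.1 z) (SweedlerH4.aut p.1.2 h)) ∧
    (∀ a : centralPrimitives k A,
      ∃ Φ : crossedAutSubgroup a ≃* (SweedlerCrossed a ≃ₐc[k] SweedlerCrossed a),
        ∀ p (z : A) (h : SweedlerH4 k),
          Φ p (SweedlerCrossed.tmul a z h) =
            SweedlerCrossed.tmul a (p.1.1 z) (SweedlerH4.aut p.1.2 h)) := by
  refine ⟨fun a b => ⟨SweedlerCrossed.pairEquiv hk hA a b,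
    SweedlerCrossed.pairEquiv_tmul hk hA a b⟩, fun a => ?_⟩
  -- For a = b the index set of pairs is by definition the carrier of G(a), so only multiplicativity
  -- remains.
  let Φ : crossedAutSubgroup a ≃ (SweedlerCrossed a ≃ₐc[k] SweedlerCrossed a) :=
    SweedlerCrossed.pairEquiv hk hA a a
  have hΦ : ∀ p z h, Φ p (SweedlerCrossed.tmul a z h) =
      SweedlerCrossed.tmul a (p.1.1 z) (SweedlerH4.aut p.1.2 h) := fun p z h =>
    SweedlerCrossed.pairEquiv_tmul hk hA a a p z h
  -- It suffices to compare on elements z # h, where the claim is the composition rule v_β v_β' =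
  -- v_{ββ'}.
  refine ⟨MulEquiv.mk' Φ fun p q => SweedlerCrossed.equiv_ext fun z h => ?_, hΦ⟩
  rw [BialgEquiv.aut_mul_apply, hΦ, hΦ, hΦ, Subgroup.coe_mul, Prod.fst_mul, Prod.snd_mul,
    BialgEquiv.aut_mul_apply, SweedlerH4.aut_apply, SweedlerH4.aut_apply, SweedlerH4.aut_apply,
    SweedlerH4.scaleHom_scaleHom, Units.val_mul]
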